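/- Let $I\subseteq\mathbb{R}$ be an open interval, $F$ a smooth manifold without boundary, $\beta\in C^\infty(I)$ a positive function and $(g_t)_{t\in I}$ a smooth one-parameter family of Riemannian metrics on $F$. Endow $I\times F$ with the Riemannian metric $\overline g=\beta\,dt^2+g_t$, that is, $\overline g=\beta\,\pi_I^*(dt^2)+\pi_F^*(g_t)$ with $\pi_I,\pi_F$ the canonical projections. Assume that $(I\times F,\overline g)$ is monotone: either it is non-shrinking throughout $\partial_t$, i.e. $\partial_t\beta\ge 0$ on $I$ and $(\partial_t g_t)(X,X)\ge 0$ for all $t\in I$ and all tangent vectors $X$ of $F$, or it is non-expanding throughout $\partial_t$, i.e. $\partial_t\beta\le 0$ on $I$ and $(\partial_t g_t)(X,X)\le 0$ for all such $t$ and $X$. Let $S$ be a compact connected smooth manifold without boundary and let $x:S\to I\times F$ be a minimal submanifold, i.e. a smooth immersion whose mean curvature vector vanishes identically. (Here, for $n=\dim S$, the mean curvature vector $H$ is given by $nH=\sum_{i=1}^n \mathrm{II}(E_i,E_i)$, where $(E_i)$ is an orthonormal basis of $T_pS$ for the induced metric and $\mathrm{II}(X,Y)=(\overline\nabla_XY)^\perp$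 is the second fundamental form, $\overline\nabla$ being the Levi-Civita connection of $\overline g$.) Then $S$ is contained in a level hypersurface $t=\mathrm{const}$: there is $t_0\in I$ with $\pi_I(x(p))=t_0$ for all $p\in S$. If moreover the codimension $\dim F+1-\dim S$ of $S$ in $I\times F$ is greater than one, then $\pi_F\circ x:S\to F$ is a minimal submanifold of the Riemannian manifold $(F,g_{t_0})$. -/

import Mathlib

open scoped Manifold ContDiff
open Bundle Module

noncomputable section

namespace MinimalSubmanifolds

/-! ### Local Riemannian geometry in vector spaces -/

section Local

variable {V W : Type*} [NormedAddCommGroup V] [NormedSpace ℝ V]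
  [NormedAddCommGroup W] [NormedSpace ℝ W]

/-- `IsChristoffelVector G y a b c` says that `c` is the value `Γ_y(a, b)` of the Christoffel
symbols at `y` of the metric `G` on (an open subset of) `W`, that is, the value at `y` of
`∇_A B` for the constant vector fields `A = a`, `B = b` and the Levi-Civita connection `∇`:
`2 G(Γ(a, b), z) = a(G(b, z)) + b(G(a, z)) - z(G(a, b))` for all `z`
(the Koszul formula for constant, hence commuting, vector fields). -/
def IsChristoffelVector (G : W → W →L[ℝ] W →L[ℝ] ℝ) (y a b c : W) : Prop :=
  ∀ z : W, 2 * G y c z = fderiv ℝ G y a b z + fderiv ℝ G y b a z - fderiv ℝ G y z a b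

/-- The Christoffel symbols `Γ_y(a, b)` of the metric `G`; see `christoffel_spec`. -/
def christoffel (G : W → W →L[ℝ] W →L[ℝ] ℝ) (y a b : W) : W :=
  Classical.epsilon (IsChristoffelVector G y a b)

/-- `IsNormalPart B T v w` says that `w` is the component of `v` that is `B`-orthogonal to the
subspace `T`. -/
def IsNormalPart (B : W →L[ℝ] W →L[ℝ] ℝ) (T : Submodule ℝ W) (v w : W) : Prop :=
  v - w ∈ T ∧ ∀ u ∈ T, B w u = 0

/-- The normal component `v^⊥` of `v` with respect to the subspace `T` and the inner product
`B`; see `normalPart_spec`. -/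
def normalPart (B : W →L[ℝ] W →L[ℝ] ℝ) (T : Submodule ℝ W) (v : W) : W :=
  Classical.epsilon (IsNormalPart B T v)

/-- The second fundamental form `II(u, v) = (∇_u (DX v))^⊥` at `y` of the parametrized
submanifold `X` of (an open subset of) `W` with the metric `G`, on constant vector fields
`u`, `v`: the covariant derivative along `X` is `D²X(u, v) + Γ_{X(y)}(DX u, DX v)`. -/
def localSecondFundamentalForm (G : W → W →L[ℝ] W →L[ℝ] ℝ) (X : V → W) (y u v : V) : W :=
  normalPart (G (X y)) (LinearMap.range (fderiv ℝ X y).toLinearMap)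
    (fderiv ℝ (fderiv ℝ X) y u v + christoffel G (X y) (fderiv ℝ X y u) (fderiv ℝ X y v))

/-- The basis `e` is orthonormal at `y` for the metric induced by `X` from `G`. -/
def IsInducedOrthonormal (G : W → W →L[ℝ] W →L[ℝ] ℝ) (X : V → W) (y : V)
    {n : ℕ} (e : Basis (Fin n) ℝ V) : Prop :=
  ∀ i j, G (X y) (fderiv ℝ X y (e i)) (fderiv ℝ X y (e j)) = if i = j then 1 else 0

/-- The mean curvature vector of `X` vanishes at `y`: `n H = ∑ i, II(e i, e i) = 0` for the
orthonormal bases `e` of the tangent space. -/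
def LocalMeanCurvatureZero (G : W → W →L[ℝ] W →L[ℝ] ℝ) (X : V → W) (y : V) : Prop :=
  ∀ e : Basis (Fin (finrank ℝ V)) ℝ V, IsInducedOrthonormal G X y e →
    ∑ i, localSecondFundamentalForm G X y (e i) (e i) = 0

section Spec

variable [FiniteDimensional ℝ W]

/-- Riesz representation for a positive definite form. -/
theorem exists_representing (B : W →L[ℝ] W →L[ℝ] ℝ) (hB : ∀ v, v ≠ 0 → 0 < B v v)
    (f : W →ₗ[ℝ] ℝ) : ∃ c, ∀ z, B c z = f z := by
  let L : W →ₗ[ℝ] (W →L[ℝ] ℝ) := B.toLinearMap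
  have hinj : Function.Injective (LinearMap.toContinuousLinearMap.symm.toLinearMap ∘ₗ L) := by
    rw [← LinearMap.ker_eq_bot, LinearMap.ker_eq_bot']
    intro v hv
    by_contra h
    have h1 : B v v = 0 := by simpa [L] using congrArg (fun l : W →ₗ[ℝ] ℝ => l v) hv
    exact (hB v h).ne' h1
  have hsurj := (LinearMap.injective_iff_surjective_of_finrank_eq_finrank
    (by simp)).1 hinj
  obtain ⟨c, hc⟩ := hsurj f
  exact ⟨c, fun z => congrArg (fun l : W →ₗ[ℝ] ℝ => l z) hc⟩

/-- The Christoffel symbols of a metric that is positive definite at `y` satisfy their defining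
equation. -/
theorem christoffel_spec (G : W → W →L[ℝ] W →L[ℝ] ℝ) (y a b : W)
    (hG : ∀ v, v ≠ 0 → 0 < G y v v) : IsChristoffelVector G y a b (christoffel G y a b) := by
  apply Classical.epsilon_spec (p := IsChristoffelVector G y a b)
  let f : W →ₗ[ℝ] ℝ := (2⁻¹ : ℝ) • ((fderiv ℝ G y a b).toLinearMap
    + (fderiv ℝ G y b a).toLinearMap - (((fderiv ℝ G y).flip a).flip b).toLinearMap)
  obtain ⟨c, hc⟩ := exists_representing (G y) hG f
  refine ⟨c, fun z => ?_⟩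
  rw [hc z]
  simp [f]

/-- Normal components exist for positive definite forms. -/
theorem normalPart_spec (B : W →L[ℝ] W →L[ℝ] ℝ) (hB : ∀ v, v ≠ 0 → 0 < B v v)
    (T : Submodule ℝ W) (v : W) : IsNormalPart B T v (normalPart B T v) := by
  apply Classical.epsilon_spec (p := IsNormalPart B T v)
  let BT : T →L[ℝ] T →L[ℝ] ℝ := B.bilinearComp T.subtypeL T.subtypeL
  obtain ⟨c, hc⟩ := exists_representing BT
    (fun u hu => hB u (by simpa using hu)) ((B v).toLinearMap ∘ₗ T.subtype)
  refine ⟨v - c, by simp, fun u hu => ?_⟩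
  have := hc ⟨u, hu⟩
  simp [BT] at this
  simp [this]

end Spec

end Local

/-! ### Minimal submanifolds of Riemannian manifolds -/

section Manifold

variable {E H M E' H' M' : Type*}
  [NormedAddCommGroup E] [NormedSpace ℝ E] [TopologicalSpace H]
  [TopologicalSpace M] [ChartedSpace H M]
  [NormedAddCommGroup E'] [NormedSpace ℝ E'] [TopologicalSpace H']
  [TopologicalSpace M'] [ChartedSpace H' M']

/-- The components of the `(0,2)`-tensor field `g` on `M` in the chart `c`, as a function on the
model vector space: the pullback of `g` by the inverse of the chart. -/
def chartMetric (J : ModelWithCorners ℝ E H)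
    (g : (q : M) → TangentSpace J q →L[ℝ] TangentSpace J q →L[ℝ] ℝ)
    (c : OpenPartialHomeomorph M H) (y : E) : E →L[ℝ] E →L[ℝ] ℝ :=
  let A : E →L[ℝ] E := mfderiv 𝓘(ℝ, E) J (c.extend J).symm y
  let B : E →L[ℝ] E →L[ℝ] ℝ := g ((c.extend J).symm y)
  B.bilinearComp A A

/-- `x : S → M` is a minimal submanifold of `M` with the Riemannian metric `g`: a smooth
immersion whose mean curvature vector vanishes at every point. The condition does not depend on
the charts in which the mean curvature vector is computed. The metric need only be defined near
the image of `x`. The manifolds are without boundary. -/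
structure IsMinimalSubmanifold (I : ModelWithCorners ℝ E' H') (J : ModelWithCorners ℝ E H)
    (g : (q : M) → TangentSpace J q →L[ℝ] TangentSpace J q →L[ℝ] ℝ) (x : M' → M) : Prop where
  contMDiff : ContMDiff I J ∞ x
  injective_mfderiv : ∀ p, Function.Injective (mfderiv I J x p)
  meanCurvature_eq_zero :
    ∀ φ ∈ IsManifold.maximalAtlas I ∞ M', ∀ ψ ∈ IsManifold.maximalAtlas J ∞ M,
      ∀ p ∈ φ.source, x p ∈ ψ.source →
        LocalMeanCurvatureZero (chartMetric J g ψ)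
          (ψ.extend J ∘ x ∘ (φ.extend I).symm) (φ.extend I p)

end Manifold

/-! ### The metrics `β dt² + g_t` on `I × F` -/

section Split

variable {k : ℕ} {F : Type*} [TopologicalSpace F] [ChartedSpace (EuclideanSpace ℝ (Fin k)) F]

/-- `g` is a smooth one-parameter family of Riemannian metrics `g t` on `F`, `t ∈ I`
(the values of `g` outside `I` are irrelevant). -/
structure IsRiemannianMetricFamily [IsManifold (𝓡 k) ∞ F] (I : Set ℝ)
    (g : ℝ → (p : F) → TangentSpace (𝓡 k) p →L[ℝ] TangentSpace (𝓡 k) p →L[ℝ] ℝ) : Prop where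
  symm : ∀ t ∈ I, ∀ p u v, g t p u v = g t p v u
  pos : ∀ t ∈ I, ∀ p v, v ≠ 0 → 0 < g t p v v
  contMDiffOn : ContMDiffOn (𝓘(ℝ, ℝ).prod (𝓡 k))
    ((𝓡 k).prod 𝓘(ℝ, EuclideanSpace ℝ (Fin k) →L[ℝ] EuclideanSpace ℝ (Fin k) →L[ℝ] ℝ)) ∞
    (fun q : ℝ × F => TotalSpace.mk'
      (EuclideanSpace ℝ (Fin k) →L[ℝ] EuclideanSpace ℝ (Fin k) →L[ℝ] ℝ)
      (E := fun p : F => TangentSpace (𝓡 k) p →L[ℝ] TangentSpace (𝓡 k) p →L[ℝ] ℝ)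
      q.2 (g q.1 q.2))
    (I ×ˢ Set.univ)

/-- The metric `β dt² + g_t`, that is, `β π_I^*(dt²) + π_F^*(g_t)`. -/
def splitMetric (β : ℝ → ℝ)
    (g : ℝ → (p : F) → TangentSpace (𝓡 k) p →L[ℝ] TangentSpace (𝓡 k) p →L[ℝ] ℝ) (q : ℝ × F) :
    TangentSpace (𝓘(ℝ, ℝ).prod (𝓡 k)) q →L[ℝ] TangentSpace (𝓘(ℝ, ℝ).prod (𝓡 k)) q →L[ℝ] ℝ :=
  let B : EuclideanSpace ℝ (Fin k) →L[ℝ] EuclideanSpace ℝ (Fin k) →L[ℝ] ℝ := g q.1 q.2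
  let dt : ℝ × EuclideanSpace ℝ (Fin k) →L[ℝ] ℝ := ContinuousLinearMap.fst ℝ _ _
  let dπ : ℝ × EuclideanSpace ℝ (Fin k) →L[ℝ] EuclideanSpace ℝ (Fin k) :=
    ContinuousLinearMap.snd ℝ _ _
  (β q.1 • (ContinuousLinearMap.mul ℝ ℝ).bilinearComp dt dt + B.bilinearComp dπ dπ :
    ℝ × EuclideanSpace ℝ (Fin k) →L[ℝ] ℝ × EuclideanSpace ℝ (Fin k) →L[ℝ] ℝ)

theorem splitMetric_apply (β : ℝ → ℝ)
    (g : ℝ → (p : F) → TangentSpace (𝓡 k) p →L[ℝ] TangentSpace (𝓡 k) p →L[ℝ] ℝ) (q : ℝ × F)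
    (a b : ℝ) (v w : TangentSpace (𝓡 k) q.2) :
    splitMetric β g q (a, v) (b, w) = β q.1 * (a * b) + g q.1 q.2 v w := rfl

/-- `β dt² + g_t` is non-shrinking throughout `∂_t`: `∂_t β ≥ 0` and `∂_t g_t ≥ 0`. -/
def IsNonShrinking (I : Set ℝ) (β : ℝ → ℝ)
    (g : ℝ → (p : F) → TangentSpace (𝓡 k) p →L[ℝ] TangentSpace (𝓡 k) p →L[ℝ] ℝ) : Prop :=
  ∀ t ∈ I, 0 ≤ deriv β t ∧
    ∀ (p : F) (v : TangentSpace (𝓡 k) p), 0 ≤ deriv (fun s => g s p v v) t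

/-- `β dt² + g_t` is non-expanding throughout `∂_t`: `∂_t β ≤ 0` and `∂_t g_t ≤ 0`. -/
def IsNonExpanding (I : Set ℝ) (β : ℝ → ℝ)
    (g : ℝ → (p : F) → TangentSpace (𝓡 k) p →L[ℝ] TangentSpace (𝓡 k) p →L[ℝ] ℝ) : Prop :=
  ∀ t ∈ I, deriv β t ≤ 0 ∧
    ∀ (p : F) (v : TangentSpace (𝓡 k) p), deriv (fun s => g s p v v) t ≤ 0

/-- `β dt² + g_t` is monotone. -/
def IsMonotone (I : Set ℝ) (β : ℝ → ℝ)
    (g : ℝ → (p : F) → TangentSpace (𝓡 k) p →L[ℝ] TangentSpace (𝓡 k) p →L[ℝ] ℝ) : Prop :=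
  IsNonShrinking I β g ∨ IsNonExpanding I β g

end Split

end MinimalSubmanifolds

end

/-!
Let `τ = π_I ∘ x` be the `t`-component of a minimal submanifold `x`. By the Koszul formula for
`β dt² + g_t`, the `t`-component of the equation `H = 0` reads
`Δτ = -β' / (2 β) |∇τ|² + (2 β)⁻¹ tr ∂_t g_t` with the trace taken over the tangent space of `S`.
Monotonicity gives the last term a sign `σ`, while the first one is bounded by `|∇τ|`; hence `σ τ`
satisfies `Δ(σ τ) ≥ -C |∇(σ τ)|` locally. By Hopf's strong maximum principle the set where `σ τ`
attains its maximum is open, so it is all of `S`. In a slice `t = t₀` the `F`-components of the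
Christoffel symbols of `β dt² + g_t` are those of `g_{t₀}`, and the `F`-component of `H = 0` says
that `π_F ∘ x` is minimal.
-/

noncomputable section

open Filter Topology Metric

namespace MinimalSubmanifolds

/-! ### The strong maximum principle -/

section SecondDerivativeTest

variable {E : Type*} [NormedAddCommGroup E] [NormedSpace ℝ E]

theorem hasDerivAt_comp_line {F : Type*} [NormedAddCommGroup F] [NormedSpace ℝ F] {f : E → F}
    {y e : E} {s : ℝ} (hf : DifferentiableAt ℝ f (y + s • e)) :
    HasDerivAt (fun s : ℝ => f (y + s • e)) (fderiv ℝ f (y + s • e) e) s := by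
  have hline : HasDerivAt (fun s : ℝ => y + s • e) e s := by
    simpa using ((hasDerivAt_id s).smul_const e).const_add y
  exact hf.hasFDerivAt.comp_hasDerivAt s hline

theorem tendsto_line (y e : E) : Tendsto (fun s : ℝ => y + s • e) (𝓝 0) (𝓝 y) := by
  have hline : Continuous fun s : ℝ => y + s • e := by fun_prop
  simpa using hline.tendsto 0

theorem fderiv_fderiv_apply_nonpos_of_isLocalMax {f : E → ℝ} {y : E} (hf : ContDiffAt ℝ 2 f y)
    (hmax : IsLocalMax f y) (e : E) : fderiv ℝ (fderiv ℝ f) y e e ≤ 0 := by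
  set g : ℝ → ℝ := fun s => f (y + s • e)
  have hgmax : IsLocalMax g 0 := by
    simpa [IsLocalMax, IsMaxFilter, g] using (tendsto_line y e).eventually hmax
  have hfdiff : ∀ᶠ x in 𝓝 y, DifferentiableAt ℝ f x :=
    (hf.eventually (by simp)).mono fun x hx => hx.differentiableAt two_ne_zero
  have hg' : deriv g =ᶠ[𝓝 0] fun s => fderiv ℝ f (y + s • e) e :=
    ((tendsto_line y e).eventually hfdiff).mono fun s hs => (hasDerivAt_comp_line hs).deriv
  have hg'' : deriv (deriv g) 0 = fderiv ℝ (fderiv ℝ f) y e e := by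
    have hdiff : DifferentiableAt ℝ (fderiv ℝ f) (y + (0 : ℝ) • e) := by
      simpa using (hf.fderiv_right (m := 1) le_rfl).differentiableAt one_ne_zero
    rw [hg'.deriv_eq]
    simpa using ((hasDerivAt_comp_line hdiff).clm_apply (hasDerivAt_const (0 : ℝ) e)).deriv
  by_contra! hpos
  have hgmin : IsLocalMin g 0 := isLocalMin_of_deriv_deriv_pos (by rwa [hg''])
    hgmax.deriv_eq_zero <| ContinuousAt.comp_of_eq (y := y) hf.continuousAt
      (by fun_prop) (by simp)
  have hconst : g =ᶠ[𝓝 0] fun _ => g 0 := by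
    filter_upwards [hgmax, hgmin] with s hle hge using le_antisymm hle hge
  have hg'const : deriv g =ᶠ[𝓝 0] fun _ => 0 := hconst.deriv.trans (by simp)
  rw [← hg'', hg'const.deriv_eq, deriv_const] at hpos
  exact hpos.false

end SecondDerivativeTest

section MaximumPrinciple

variable {E : Type*} [NormedAddCommGroup E] {α ε M : ℝ} {z p y : E} {u : E → ℝ}

/-- The barrier `exp (-α |x - z|²)` of Hopf's proof of the strong maximum principle. -/
def hopfBarrier (α : ℝ) (z x : E) : ℝ :=
  Real.exp (-α * ‖x - z‖ ^ 2)

theorem hopfBarrier_pos (α : ℝ) (z x : E) : 0 < hopfBarrier α z x :=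
  Real.exp_pos _

theorem exists_add_hopfBarrier_lt {s : Set E} (hs : IsCompact s) (hu : ContinuousOn u s)
    (hα : 0 < α) (hle : ∀ y ∈ s, u y ≤ M) (hlt : ∀ y ∈ s ∩ closedBall z (dist p z), u y < M) :
    ∃ ε > 0, ∀ y ∈ s, u y + ε * hopfBarrier α z y < M + ε * hopfBarrier α z p := by
  obtain ⟨ε, hε, hgap⟩ : ∃ ε, 0 < ε ∧ ∀ y ∈ s ∩ closedBall z (dist p z), ε ≤ M - u y :=
    (hs.inter_right isClosed_closedBall).exists_forall_le'
      (continuousOn_const.sub (hu.mono Set.inter_subset_left)) fun y hy => sub_pos.2 (hlt y hy)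
  refine ⟨ε, hε, fun y hy => ?_⟩
  by_cases hyz : y ∈ closedBall z (dist p z)
  · have hone : hopfBarrier α z y ≤ 1 :=
      Real.exp_le_one_iff.2 (by nlinarith [sq_nonneg ‖y - z‖])
    have := hgap y ⟨hy, hyz⟩
    nlinarith [mul_pos hε (hopfBarrier_pos α z p)]
  · have hfar : ‖p - z‖ < ‖y - z‖ := by simpa [dist_eq_norm] using hyz
    have hsq : ‖p - z‖ ^ 2 < ‖y - z‖ ^ 2 := by gcongr
    have hdecay : hopfBarrier α z y < hopfBarrier α z p := Real.exp_lt_exp.2 (by nlinarith)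
    have := hle y hy
    nlinarith

variable [InnerProductSpace ℝ E]

theorem contDiff_hopfBarrier {n : ℕ∞} (α : ℝ) (z : E) : ContDiff ℝ n (hopfBarrier α z) :=
  Real.contDiff_exp.comp (contDiff_const.mul ((contDiff_id.sub contDiff_const).norm_sq ℝ))

theorem hasFDerivAt_hopfBarrier (α : ℝ) (z x : E) :
    HasFDerivAt (hopfBarrier α z) ((-(2 * α) * hopfBarrier α z x) • innerSL ℝ (x - z)) x := by
  have hnorm := (((hasFDerivAt_id x).sub_const z).norm_sq.const_mul (-α)).exp
  refine hnorm.congr_fderiv ?_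
  ext e
  simp [hopfBarrier]
  ring

theorem fderiv_hopfBarrier (α : ℝ) (z : E) :
    fderiv ℝ (hopfBarrier α z)
      = fun x => (-(2 * α) * hopfBarrier α z x) • innerSL ℝ (x - z) :=
  funext fun x => (hasFDerivAt_hopfBarrier α z x).fderiv

theorem fderiv_fderiv_hopfBarrier (α : ℝ) (z x e : E) :
    fderiv ℝ (fderiv ℝ (hopfBarrier α z)) x e e
      = hopfBarrier α z x * (4 * α ^ 2 * inner ℝ (x - z) e ^ 2 - 2 * α * ‖e‖ ^ 2) := by
  have hinner : HasFDerivAt (fun x : E => innerSL ℝ (x - z)) (innerSL ℝ) x :=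
    (innerSL ℝ).hasFDerivAt.comp x ((hasFDerivAt_id x).sub_const z)
  have hself : (innerSL ℝ : E →L[ℝ] E →L[ℝ] ℝ) e e = ‖e‖ ^ 2 := real_inner_self_eq_norm_sq e
  have hder := ((hasFDerivAt_hopfBarrier α z x).const_mul (-(2 * α))).fun_smul hinner
  rw [fderiv_hopfBarrier, hder.fderiv]
  simp only [add_apply, smul_apply, ContinuousLinearMap.smulRight_apply, innerSL_apply_apply,
    smul_eq_mul, hself]
  ring

/-- The vectors `e i` are the directions of an elliptic operator `u ↦ ∑ D²u(e i, e i)`, with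
ellipticity constant `Λ`. -/
structure IsEllipticFrame {ι : Type*} [Fintype ι] (Λ : ℝ) (e : ι → E) : Prop where
  sum_norm_sq_le : ∑ i, ‖e i‖ ^ 2 ≤ Λ
  norm_sq_le : ∀ v, ‖v‖ ^ 2 ≤ Λ * ∑ i, inner ℝ v (e i) ^ 2

theorem IsEllipticFrame.mono {ι : Type*} [Fintype ι] {Λ Λ' : ℝ} {e : ι → E}
    (he : IsEllipticFrame Λ e) (hΛ : Λ ≤ Λ') : IsEllipticFrame Λ' e where
  sum_norm_sq_le := he.sum_norm_sq_le.trans hΛ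
  norm_sq_le v := (he.norm_sq_le v).trans (by gcongr)

/-- `u` satisfies at `y` a differential inequality `∑ D²u(e i, e i) ≥ -C |Du|`, where `e` is an
elliptic frame with constant `Λ`. -/
def IsSubsolutionAt (ι : Type*) [Fintype ι] (Λ C : ℝ) (u : E → ℝ) (y : E) : Prop :=
  ∃ e : ι → E, IsEllipticFrame Λ e ∧
    -(C * ‖fderiv ℝ u y‖) ≤ ∑ i, fderiv ℝ (fderiv ℝ u) y (e i) (e i)

variable {ι : Type*} [Fintype ι] {Λ C : ℝ}

theorem IsSubsolutionAt.mono {C' : ℝ} (h : IsSubsolutionAt ι Λ C u y) (hC : C ≤ C') :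
    IsSubsolutionAt ι Λ C' u y := by
  obtain ⟨e, he, hle⟩ := h
  exact ⟨e, he, (neg_le_neg (mul_le_mul_of_nonneg_right hC (norm_nonneg _))).trans hle⟩

theorem norm_fderiv_of_isLocalMax_add_hopfBarrier (hu : DifferentiableAt ℝ u y) (hα : 0 ≤ α)
    (hε : 0 ≤ ε) (hmax : IsLocalMax (fun x => u x + ε * hopfBarrier α z x) y) :
    ‖fderiv ℝ u y‖ = ε * hopfBarrier α z y * (2 * α * ‖y - z‖) := by
  have hder := hu.hasFDerivAt.add ((hasFDerivAt_hopfBarrier α z y).const_mul ε)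
  have hzero : fderiv ℝ u y = (ε * hopfBarrier α z y * (2 * α)) • innerSL ℝ (y - z) := by
    rw [← sub_eq_zero, ← hmax.hasFDerivAt_eq_zero hder]
    module
  have hpos := hopfBarrier_pos α z y
  rw [hzero, norm_smul, innerSL_apply_norm, Real.norm_of_nonneg (by positivity)]
  ring

theorem fderiv_fderiv_le_of_isLocalMax_add_hopfBarrier (hu : ContDiffAt ℝ 2 u y)
    (hmax : IsLocalMax (fun x => u x + ε * hopfBarrier α z x) y) (e : E) :
    fderiv ℝ (fderiv ℝ u) y e e
      ≤ ε * hopfBarrier α z y * (2 * α * ‖e‖ ^ 2 - 4 * α ^ 2 * inner ℝ (y - z) e ^ 2) := by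
  have hbar : ContDiffAt ℝ 2 (hopfBarrier α z) y :=
    (contDiff_hopfBarrier α z).contDiffAt
  have hfst : fderiv ℝ (fun x => u x + ε * hopfBarrier α z x)
      =ᶠ[𝓝 y] fderiv ℝ u + ε • fderiv ℝ (hopfBarrier α z) := by
    filter_upwards [hu.eventually (by simp)] with x hx
    exact ((hx.differentiableAt two_ne_zero).hasFDerivAt.add
      ((hasFDerivAt_hopfBarrier α z x).differentiableAt.hasFDerivAt.const_mul ε)).fderiv
  have hsnd := ((hu.fderiv_right (m := 1) le_rfl).differentiableAt one_ne_zero).hasFDerivAt.add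
    (((hbar.fderiv_right (m := 1) le_rfl).differentiableAt one_ne_zero).hasFDerivAt.const_smul ε)
  have htest :=
    fderiv_fderiv_apply_nonpos_of_isLocalMax (hu.add (contDiffAt_const.mul hbar)) hmax e
  rw [hfst.fderiv_eq, hsnd.fderiv] at htest
  simp only [add_apply, smul_apply, smul_eq_mul, fderiv_fderiv_hopfBarrier] at htest
  linarith

theorem not_isLocalMax_add_hopfBarrier {r R : ℝ} (hu : ContDiffAt ℝ 2 u y)
    (hsub : IsSubsolutionAt ι Λ C u y) (hC : 0 ≤ C) (hα : 0 < α) (hε : 0 < ε) (hr : 0 ≤ r)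
    (hry : r ≤ ‖y - z‖) (hyR : ‖y - z‖ ≤ R) (hbig : Λ * (Λ + C * R) < 2 * α * r ^ 2) :
    ¬ IsLocalMax (fun x => u x + ε * hopfBarrier α z x) y := by
  intro hmax
  obtain ⟨e, he, hle⟩ := hsub
  have hΛ : 0 ≤ Λ := (Finset.sum_nonneg fun i _ => sq_nonneg ‖e i‖).trans he.sum_norm_sq_le
  set K := ε * hopfBarrier α z y
  have hK : 0 < K := mul_pos hε (hopfBarrier_pos α z y)
  set Q := ∑ i, inner ℝ (y - z) (e i) ^ 2
  have htrace : ∑ i, fderiv ℝ (fderiv ℝ u) y (e i) (e i)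
      ≤ K * (2 * α * ∑ i, ‖e i‖ ^ 2 - 4 * α ^ 2 * Q) := by
    rw [Finset.mul_sum, Finset.mul_sum, ← Finset.sum_sub_distrib, Finset.mul_sum]
    exact Finset.sum_le_sum fun i _ =>
      fderiv_fderiv_le_of_isLocalMax_add_hopfBarrier hu hmax (e i)
  rw [norm_fderiv_of_isLocalMax_add_hopfBarrier (hu.differentiableAt two_ne_zero) hα.le hε.le
    hmax] at hle
  have hbalance : 0 ≤ 2 * α * K * (C * ‖y - z‖ + ∑ i, ‖e i‖ ^ 2 - 2 * α * Q) := by linarith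
  have hQ : 2 * α * Q ≤ Λ + C * R := by
    have := nonneg_of_mul_nonneg_right hbalance (by positivity)
    have := he.sum_norm_sq_le
    have : C * ‖y - z‖ ≤ C * R := by gcongr
    linarith
  have hrQ : r ^ 2 ≤ Λ * Q := (by gcongr : r ^ 2 ≤ ‖y - z‖ ^ 2).trans (he.norm_sq_le (y - z))
  refine hbig.not_ge ?_
  calc 2 * α * r ^ 2 ≤ 2 * α * (Λ * Q) := by gcongr
    _ = Λ * (2 * α * Q) := by ring
    _ ≤ Λ * (Λ + C * R) := by gcongr

/-- Hopf's argument at a boundary point of a ball: otherwise `u` plus a small multiple of the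
barrier centred at `z` would have a local maximum close to `p`. -/
theorem exists_eq_of_isMaxOn_ball [FiniteDimensional ℝ E] {ρ : ℝ} (hρ : 0 < ρ) (hC : 0 ≤ C)
    (hu : ∀ y ∈ ball p ρ, ContDiffAt ℝ 2 u y)
    (hsub : ∀ y ∈ ball p ρ, IsSubsolutionAt ι Λ C u y)
    (hmax : ∀ y ∈ ball p ρ, u y ≤ u p) (hzp : z ≠ p) :
    ∃ y ∈ ball p ρ, y ≠ p ∧ dist y z ≤ dist p z ∧ u y = u p := by
  by_contra! hne
  set R := dist p z
  have hR : 0 < R := dist_pos.2 hzp.symm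
  obtain ⟨r, hr, hrlt⟩ := exists_between (lt_min (half_pos hR) hρ)
  obtain ⟨hrR, hrρ⟩ := lt_min_iff.1 hrlt
  obtain ⟨α, hα, hbig⟩ : ∃ α > 0, Λ * (Λ + C * (2 * R)) < 2 * α * (R / 2) ^ 2 := by
    obtain ⟨α, hα⟩ := exists_gt (max 0 (Λ * (Λ + C * (2 * R)) / (2 * (R / 2) ^ 2)))
    obtain ⟨hpos, hlt⟩ := max_lt_iff.1 hα
    exact ⟨α, hpos, by rw [div_lt_iff₀ (by positivity)] at hlt; linarith⟩
  have hcont : ContinuousOn u (closedBall p r) := fun y hy =>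
    (hu y (closedBall_subset_ball hrρ hy)).continuousAt.continuousWithinAt
  have hsphere : sphere p r ⊆ closedBall p r := sphere_subset_closedBall
  have hsphere' : sphere p r ⊆ ball p ρ := hsphere.trans (closedBall_subset_ball hrρ)
  obtain ⟨ε, hε, hlt⟩ := exists_add_hopfBarrier_lt (z := z) (p := p) (isCompact_sphere p r)
    (hcont.mono hsphere) hα (fun y hy => hmax y (hsphere' hy)) fun y hy =>
    (hmax y (hsphere' hy.1)).lt_of_ne
      (hne y (hsphere' hy.1) (ne_of_mem_sphere hy.1 hr.ne') hy.2)
  obtain ⟨m, hm, hmmax⟩ := (isCompact_closedBall p r).exists_isLocalMax_mem_open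
    (f := fun x => u x + ε * hopfBarrier α z x) ball_subset_closedBall
    (hcont.add ((contDiff_hopfBarrier (n := 0) α z).continuous.const_mul ε).continuousOn)
    (mem_closedBall_self hr.le) (by simpa using hlt) isOpen_ball
  have hmρ : m ∈ ball p ρ := ball_subset_ball hrρ.le hm
  refine not_isLocalMax_add_hopfBarrier (r := R / 2) (R := 2 * R) (hu m hmρ) (hsub m hmρ) hC hα
    hε (half_pos hR).le ?_ ?_ hbig hmmax
  · linarith [dist_triangle_left p z m, dist_eq_norm m z, mem_ball.1 hm]
  · linarith [dist_triangle m p z, dist_eq_norm m z, mem_ball.1 hm]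

theorem eq_of_dist_midpoint_le (hmid : dist y (midpoint ℝ z p) ≤ dist z p / 2)
    (hle : dist z p ≤ dist z y) : y = p := by
  have hz : dist z (midpoint ℝ z p) = dist z p / 2 := by
    rw [dist_left_midpoint, Real.norm_ofNat]; ring
  have htri := dist_triangle z (midpoint ℝ z p) y
  rw [dist_comm y] at hmid
  have hmidpoint : midpoint ℝ z p = midpoint ℝ z y :=
    eq_midpoint_of_dist_eq_half (by linarith) (by linarith)
  rw [midpoint_eq_smul_add, midpoint_eq_smul_add] at hmidpoint
  simpa [eq_comm] using hmidpoint

/-- If `u z ≠ u p`, apply Hopf's argument at a point `q` of `{u = u p}` nearest to `z` and the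
ball with diameter `[z, q]`, which meets `{u = u p}` only in `q`. -/
theorem eventually_eq_of_isLocalMax [FiniteDimensional ℝ E] (hC : 0 ≤ C)
    (hu : ContDiffAt ℝ 2 u p) (hsub : ∀ᶠ y in 𝓝 p, IsSubsolutionAt ι Λ C u y)
    (hmax : IsLocalMax u p) : ∀ᶠ y in 𝓝 p, u y = u p := by
  obtain ⟨ρ, hρ, hball⟩ := Metric.eventually_nhds_iff_ball.1
    ((hu.eventually (by simp)).and (hsub.and hmax))
  filter_upwards [ball_mem_nhds p (by positivity : 0 < ρ / 4)] with z hz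
  by_contra hzp
  set A := closedBall p (ρ / 2) ∩ u ⁻¹' {u p}
  have hcont : ContinuousOn u (closedBall p (ρ / 2)) := fun y hy =>
    (hball y (closedBall_subset_ball (by linarith) hy)).1.continuousAt.continuousWithinAt
  have hA : IsCompact A := (isCompact_closedBall p (ρ / 2)).of_isClosed_subset
    (hcont.preimage_isClosed_of_isClosed isClosed_closedBall isClosed_singleton)
    Set.inter_subset_left
  have hpA : p ∈ A := ⟨mem_closedBall_self (by positivity), rfl⟩
  obtain ⟨q, hqA, hq⟩ := hA.exists_infDist_eq_dist ⟨p, hpA⟩ z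
  have hnearest : ∀ y ∈ A, dist z q ≤ dist z y := fun y hy => hq ▸ infDist_le_dist_of_mem hy
  have hqp : u q = u p := hqA.2
  have hqz : z ≠ q := by rintro rfl; exact hzp hqp
  have hqball : dist q p < ρ / 2 := by
    linarith [dist_triangle_left q p z, hnearest p hpA, mem_ball.1 hz]
  have hδ : 0 < ρ / 2 - dist q p := sub_pos.2 hqball
  have hsubset : ball q (ρ / 2 - dist q p) ⊆ ball p (ρ / 2) := ball_subset_ball' (by linarith)
  have hball' : ∀ y ∈ ball q (ρ / 2 - dist q p), _ := fun y hy =>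
    hball y (ball_subset_ball (by linarith) (hsubset hy))
  obtain ⟨y, hy, hyq, hymid, hyu⟩ := exists_eq_of_isMaxOn_ball (z := midpoint ℝ z q) hδ hC
    (fun y hy => (hball' y hy).1) (fun y hy => (hball' y hy).2.1)
    (fun y hy => hqp ▸ (hball' y hy).2.2) (by simpa using hqz)
  refine hyq (eq_of_dist_midpoint_le (z := z) ?_
    (hnearest y ⟨ball_subset_closedBall (hsubset hy), hyu.trans hqp⟩))
  rwa [dist_right_midpoint, Real.norm_ofNat, ← div_eq_inv_mul] at hymid

end MaximumPrinciple

section ShortcutInstances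

variable {V V' W : Type*} [NormedAddCommGroup V] [NormedSpace ℝ V] [NormedAddCommGroup V']
  [NormedSpace ℝ V'] [NormedAddCommGroup W] [NormedSpace ℝ W]

-- Instance search through iterated spaces of operators otherwise times out.
instance instNormedAddCommGroupBilinear : NormedAddCommGroup (V →L[ℝ] V' →L[ℝ] W) :=
  ContinuousLinearMap.toNormedAddCommGroup

instance instNormedSpaceBilinear : NormedSpace ℝ (V →L[ℝ] V' →L[ℝ] W) :=
  ContinuousLinearMap.toNormedSpace

instance instNormedAddCommGroupTrilinear : NormedAddCommGroup (W →L[ℝ] W →L[ℝ] W →L[ℝ] ℝ) :=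
  ContinuousLinearMap.toNormedAddCommGroup

end ShortcutInstances

/-! ### Positive definite forms -/

section Forms

theorem exists_eventually_norm_sq_le {V Y : Type*} [NormedAddCommGroup V] [NormedSpace ℝ V]
    [FiniteDimensional ℝ V] [TopologicalSpace Y] {B : Y → V →L[ℝ] V →L[ℝ] ℝ} {p : Y}
    (hB : ContinuousAt B p) (hpos : ∀ v, v ≠ 0 → 0 < B p v v) :
    ∃ K > 0, ∀ᶠ y in 𝓝 p, ∀ v, ‖v‖ ^ 2 ≤ K * B y v v := by
  have hsphere : IsCompact (sphere (0 : V) 1) := isCompact_sphere 0 1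
  obtain ⟨c, hc, hmin⟩ := hsphere.exists_forall_le' (f := fun v => B p v v) (by fun_prop)
    fun v hv => hpos v (ne_of_mem_sphere hv one_ne_zero)
  have hev : ∀ᶠ y in 𝓝 p, ∀ v ∈ sphere (0 : V) 1, c / 2 < B y v v := by
    refine hsphere.eventually_forall_of_forall_eventually fun v hv => ?_
    have hcont : ContinuousAt (fun q : Y × V => B q.1 q.2 q.2) (p, v) := by
      have : ContinuousAt (fun q : Y × V => B q.1) (p, v) :=
        ContinuousAt.comp (f := Prod.fst) hB continuousAt_fst
      exact (this.clm_apply continuousAt_snd).clm_apply continuousAt_snd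
    exact hcont.eventually_const_lt ((half_lt_self hc).trans_le (hmin v hv))
  refine ⟨2 / c, by positivity, hev.mono fun y hy v => ?_⟩
  rcases eq_or_ne v 0 with rfl | hv
  · simp
  have hnorm : 0 < ‖v‖ := norm_pos_iff.2 hv
  have hunit := hy (‖v‖⁻¹ • v) (by simp [norm_smul, hnorm.ne'])
  simp only [map_smul, smul_apply, smul_eq_mul] at hunit
  have hscaled : c / 2 * ‖v‖ ^ 2 ≤ B y v v :=
    calc c / 2 * ‖v‖ ^ 2 ≤ ‖v‖⁻¹ * (‖v‖⁻¹ * B y v v) * ‖v‖ ^ 2 := by gcongr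
      _ = B y v v := by field_simp
  rw [div_mul_eq_mul_div, le_div_iff₀ hc]
  linarith

theorem eventually_pos {V Y : Type*} [NormedAddCommGroup V] [NormedSpace ℝ V]
    [FiniteDimensional ℝ V] [TopologicalSpace Y] {B : Y → V →L[ℝ] V →L[ℝ] ℝ} {p : Y}
    (hB : ContinuousAt B p) (hpos : ∀ v, v ≠ 0 → 0 < B p v v) :
    ∀ᶠ y in 𝓝 p, ∀ v, v ≠ 0 → 0 < B y v v := by
  obtain ⟨K, hK, hev⟩ := exists_eventually_norm_sq_le hB hpos
  exact hev.mono fun y hy v hv =>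
    pos_of_mul_pos_right ((by positivity : 0 < ‖v‖ ^ 2).trans_le (hy v)) hK.le

theorem exists_orthonormal_basis {V : Type*} [NormedAddCommGroup V] [NormedSpace ℝ V]
    [FiniteDimensional ℝ V] {B : V →L[ℝ] V →L[ℝ] ℝ} (hsymm : ∀ v w, B v w = B w v)
    (hpos : ∀ v, v ≠ 0 → 0 < B v v) :
    ∃ e : Basis (Fin (finrank ℝ V)) ℝ V, ∀ i j, B (e i) (e j) = if i = j then 1 else 0 := by
  obtain ⟨b, hb⟩ := LinearMap.BilinForm.exists_orthogonal_basis (B := B.toLinearMap₁₂)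
    ⟨fun v w => hsymm v w⟩
  have hbpos : ∀ i, 0 < B (b i) (b i) := fun i => hpos _ (b.ne_zero i)
  refine ⟨b.isUnitSMul (w := fun i => (√(B (b i) (b i)))⁻¹) fun i =>
    (inv_ne_zero (Real.sqrt_pos.2 (hbpos i)).ne').isUnit, fun i j => ?_⟩
  simp only [Basis.isUnitSMul_apply, map_smul, smul_apply, smul_eq_mul]
  split_ifs with hij
  · subst hij
    rw [← mul_assoc, ← mul_inv, Real.mul_self_sqrt (hbpos i).le, inv_mul_cancel₀ (hbpos i).ne']
  · have hzero : B (b i) (b j) = 0 := hb hij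
    simp [hzero]

variable {V : Type*} [NormedAddCommGroup V] [InnerProductSpace ℝ V] {n : ℕ}

theorem isEllipticFrame_of_orthonormal {B : V →L[ℝ] V →L[ℝ] ℝ} {K : ℝ}
    (hB : ∀ v, ‖v‖ ^ 2 ≤ K * B v v) {e : Basis (Fin n) ℝ V}
    (he : ∀ i j, B (e i) (e j) = if i = j then 1 else 0) :
    IsEllipticFrame (max (n * K) ‖B‖) e where
  sum_norm_sq_le := by
    refine (Finset.sum_le_sum fun i _ => hB (e i)).trans ?_
    simp [he]
  norm_sq_le v := by
    set c := e.repr v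
    set Q := ∑ i, inner ℝ v (e i) ^ 2
    have hQ : 0 ≤ Q := Finset.sum_nonneg fun i _ => sq_nonneg _
    have hv : ∑ i, c i • e i = v := e.sum_repr v
    have hBv : ∑ i, c i ^ 2 = B v v := by
      rw [← hv]
      simp [he, pow_two]
    have hinner : ∑ i, c i * inner ℝ v (e i) = ‖v‖ ^ 2 :=
      calc ∑ i, c i * inner ℝ v (e i) = inner ℝ v (∑ i, c i • e i) := by
            simp [inner_sum, real_inner_smul_right]
        _ = ‖v‖ ^ 2 := by rw [hv, real_inner_self_eq_norm_sq]
    have hcauchy : ‖v‖ ^ 2 * ‖v‖ ^ 2 ≤ ‖v‖ ^ 2 * (‖B‖ * Q) :=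
      calc ‖v‖ ^ 2 * ‖v‖ ^ 2 ≤ B v v * Q := by
            rw [← hBv, ← hinner, ← pow_two]
            exact Finset.sum_mul_sq_le_sq_mul_sq _ _ _
        _ ≤ ‖B‖ * ‖v‖ * ‖v‖ * Q := by
            gcongr
            exact (le_abs_self _).trans (B.le_opNorm₂ v v)
        _ = ‖v‖ ^ 2 * (‖B‖ * Q) := by ring
    rcases eq_or_ne v 0 with hv0 | hv0
    · rw [hv0, norm_zero, zero_pow two_ne_zero]
      exact mul_nonneg (le_max_of_le_right (norm_nonneg B)) hQ
    · refine (le_of_mul_le_mul_left hcauchy (by positivity)).trans ?_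
      gcongr
      exact le_max_right _ _

end Forms

/-! ### Submanifolds of a vector space with a Riemannian metric -/

section LocalGeometry

variable {V W : Type*} [NormedAddCommGroup V] [NormedSpace ℝ V]
  [NormedAddCommGroup W] [NormedSpace ℝ W] {G G' : W → W →L[ℝ] W →L[ℝ] ℝ} {X : V → W} {y p : V}

theorem contDiffAt_bilinearComp {U : Type*} [NormedAddCommGroup U] [NormedSpace ℝ U]
    {n : WithTop ℕ∞} {B : V → W →L[ℝ] W →L[ℝ] ℝ} {A A' : V → U →L[ℝ] W}
    (hB : ContDiffAt ℝ n B p) (hA : ContDiffAt ℝ n A p) (hA' : ContDiffAt ℝ n A' p) :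
    ContDiffAt ℝ n (fun y => (B y).bilinearComp (A y) (A' y)) p :=
  ((ContinuousLinearMap.flipₗᵢ ℝ U U ℝ).contDiff.contDiffAt.comp p
    ((ContinuousLinearMap.flipₗᵢ ℝ U W ℝ).contDiff.contDiffAt.comp p (hB.clm_comp hA)
      |>.clm_comp hA'))

theorem eq_of_forall_apply_eq {B : W →L[ℝ] W →L[ℝ] ℝ} (hB : ∀ v, v ≠ 0 → 0 < B v v) {v w : W}
    (h : ∀ z, B v z = B w z) : v = w := by
  by_contra hne
  have hzero : ∀ z, B (v - w) z = 0 := fun z => by rw [B.map_sub, sub_apply, h, sub_self]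
  exact (hB (v - w) (sub_ne_zero.2 hne)).ne' (hzero _)

theorem IsChristoffelVector.eq_christoffel [FiniteDimensional ℝ W] {q a b c : W}
    (hG : ∀ v, v ≠ 0 → 0 < G q v v) (hc : IsChristoffelVector G q a b c) :
    c = christoffel G q a b :=
  eq_of_forall_apply_eq hG fun z => by linarith [hc z, christoffel_spec G q a b hG z]

theorem IsNormalPart.unique {B : W →L[ℝ] W →L[ℝ] ℝ} (hB : ∀ v, v ≠ 0 → 0 < B v v)
    {T : Submodule ℝ W} {v w w' : W} (hw : IsNormalPart B T v w) (hw' : IsNormalPart B T v w') :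
    w = w' := by
  have hT : w - w' ∈ T := by simpa using T.sub_mem hw'.1 hw.1
  have hzero : B (w - w') (w - w') = 0 := by
    rw [B.map_sub, sub_apply, hw.2 _ hT, hw'.2 _ hT, sub_self]
  by_contra hne
  exact (hB (w - w') (sub_ne_zero.2 hne)).ne' hzero

theorem IsNormalPart.sum {ι : Type*} {s : Finset ι} {B : W →L[ℝ] W →L[ℝ] ℝ} {T : Submodule ℝ W}
    {v w : ι → W} (h : ∀ i ∈ s, IsNormalPart B T (v i) (w i)) :
    IsNormalPart B T (∑ i ∈ s, v i) (∑ i ∈ s, w i) := by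
  refine ⟨?_, fun u hu => ?_⟩
  · rw [← Finset.sum_sub_distrib]
    exact T.sum_mem fun i hi => (h i hi).1
  · rw [map_sum, sum_apply]
    exact Finset.sum_eq_zero fun i hi => (h i hi).2 u hu

theorem sum_normalPart_eq_zero_iff [FiniteDimensional ℝ W] {ι : Type*} [Fintype ι]
    {B : W →L[ℝ] W →L[ℝ] ℝ} (hB : ∀ v, v ≠ 0 → 0 < B v v) (T : Submodule ℝ W) (v : ι → W) :
    ∑ i, normalPart B T (v i) = 0 ↔ ∑ i, v i ∈ T := by
  have hsum : IsNormalPart B T (∑ i, v i) (∑ i, normalPart B T (v i)) :=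
    IsNormalPart.sum fun i _ => normalPart_spec B hB T (v i)
  refine ⟨fun h => by simpa [h] using hsum.1, fun h => hsum.unique hB ⟨by simpa using h, by simp⟩⟩

/-- The second covariant derivative `∇_v (DX v)` of `X` in the direction of the constant vector
field `v`, whose normal part is the second fundamental form. -/
def covariantAcceleration (G : W → W →L[ℝ] W →L[ℝ] ℝ) (X : V → W) (y v : V) : W :=
  fderiv ℝ (fderiv ℝ X) y v v + christoffel G (X y) (fderiv ℝ X y v) (fderiv ℝ X y v)

/-- The first fundamental form of `X`, that is, the pullback of the metric `G` by `X`. -/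
def inducedMetric (G : W → W →L[ℝ] W →L[ℝ] ℝ) (X : V → W) (y : V) : V →L[ℝ] V →L[ℝ] ℝ :=
  (G (X y)).bilinearComp (fderiv ℝ X y) (fderiv ℝ X y)

theorem inducedMetric_apply (v w : V) :
    inducedMetric G X y v w = G (X y) (fderiv ℝ X y v) (fderiv ℝ X y w) :=
  rfl

theorem inducedMetric_pos (hpos : ∀ w, w ≠ 0 → 0 < G (X y) w w)
    (hinj : Function.Injective (fderiv ℝ X y)) (v : V) (hv : v ≠ 0) :
    0 < inducedMetric G X y v v :=
  hpos _ ((map_ne_zero_iff _ hinj).2 hv)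

theorem contDiffAt_inducedMetric {n : WithTop ℕ∞} (hG : ContDiffAt ℝ n G (X p))
    (hX : ContDiffAt ℝ (n + 1) X p) : ContDiffAt ℝ n (inducedMetric G X) p :=
  contDiffAt_bilinearComp (hG.comp p (hX.of_le le_self_add)) (hX.fderiv_right le_rfl)
    (hX.fderiv_right le_rfl)

theorem exists_isInducedOrthonormal [FiniteDimensional ℝ V]
    (hsymm : ∀ a b, G (X y) a b = G (X y) b a) (hpos : ∀ w, w ≠ 0 → 0 < G (X y) w w)
    (hinj : Function.Injective (fderiv ℝ X y)) :
    ∃ e : Basis (Fin (finrank ℝ V)) ℝ V, IsInducedOrthonormal G X y e :=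
  exists_orthonormal_basis (B := inducedMetric G X y) (fun _ _ => hsymm _ _)
    (inducedMetric_pos hpos hinj)

theorem localMeanCurvatureZero_iff [FiniteDimensional ℝ W]
    (hpos : ∀ w, w ≠ 0 → 0 < G (X y) w w) :
    LocalMeanCurvatureZero G X y ↔
      ∀ e : Basis (Fin (finrank ℝ V)) ℝ V, IsInducedOrthonormal G X y e →
        ∃ ξ, fderiv ℝ X y ξ = ∑ i, covariantAcceleration G X y (e i) :=
  forall₂_congr fun _ _ => sum_normalPart_eq_zero_iff hpos _ _

theorem LocalMeanCurvatureZero.congr_metric (h : LocalMeanCurvatureZero G X y)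
    (hG : G =ᶠ[𝓝 (X y)] G') : LocalMeanCurvatureZero G' X y := by
  have hval : G (X y) = G' (X y) := hG.eq_of_nhds
  have hchr : christoffel G (X y) = christoffel G' (X y) := by
    funext a b
    unfold christoffel IsChristoffelVector
    rw [hval, hG.fderiv_eq]
  simpa only [LocalMeanCurvatureZero, IsInducedOrthonormal, localSecondFundamentalForm, hval,
    hchr] using h

theorem abs_apply_christoffel_le [FiniteDimensional ℝ W] {q : W}
    (hpos : ∀ w, w ≠ 0 → 0 < G q w w) (a b c : W) :
    |G q (christoffel G q a b) c| ≤ 3 / 2 * (‖fderiv ℝ G q‖ * ‖a‖ * ‖b‖ * ‖c‖) := by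
  have hDG : ∀ u v w : W, |fderiv ℝ G q u v w| ≤ ‖fderiv ℝ G q‖ * ‖u‖ * ‖v‖ * ‖w‖ :=
    fun u v w => ((fderiv ℝ G q u).le_opNorm₂ v w).trans
      (by gcongr; exact (fderiv ℝ G q).le_opNorm u)
  have hkoszul := christoffel_spec G q a b hpos c
  have habc := abs_le.1 (hDG a b c)
  have hbac := abs_le.1 (hDG b a c)
  have hcab := abs_le.1 (hDG c a b)
  rw [abs_le]
  constructor <;> linarith

theorem abs_apply_covariantAcceleration_le [FiniteDimensional ℝ W]
    (hpos : ∀ w, w ≠ 0 → 0 < G (X y) w w) (v w : V) :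
    |G (X y) (covariantAcceleration G X y v) (fderiv ℝ X y w)|
      ≤ (‖G (X y)‖ * ‖fderiv ℝ (fderiv ℝ X) y‖ * ‖fderiv ℝ X y‖
        + 3 / 2 * (‖fderiv ℝ G (X y)‖ * ‖fderiv ℝ X y‖ ^ 3)) * (‖v‖ ^ 2 * ‖w‖) := by
  set a := fderiv ℝ X y v
  set b := fderiv ℝ X y w
  have ha : ‖a‖ ≤ ‖fderiv ℝ X y‖ * ‖v‖ := ContinuousLinearMap.le_opNorm _ _
  have hb : ‖b‖ ≤ ‖fderiv ℝ X y‖ * ‖w‖ := ContinuousLinearMap.le_opNorm _ _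
  have hchr : |G (X y) (christoffel G (X y) a a) b|
      ≤ 3 / 2 * (‖fderiv ℝ G (X y)‖ * (‖fderiv ℝ X y‖ * ‖v‖) * (‖fderiv ℝ X y‖ * ‖v‖)
        * (‖fderiv ℝ X y‖ * ‖w‖)) :=
    (abs_apply_christoffel_le hpos a a b).trans (by gcongr)
  have hacc : |G (X y) (fderiv ℝ (fderiv ℝ X) y v v) b|
      ≤ ‖G (X y)‖ * (‖fderiv ℝ (fderiv ℝ X) y‖ * ‖v‖ * ‖v‖) * (‖fderiv ℝ X y‖ * ‖w‖) := by
    refine ((G (X y)).le_opNorm₂ _ _).trans ?_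
    gcongr
    exact (fderiv ℝ (fderiv ℝ X) y).le_opNorm₂ v v
  rw [covariantAcceleration, map_add, add_apply]
  refine (abs_add_le _ _).trans ((add_le_add hacc hchr).trans_eq ?_)
  ring

theorem norm_le_of_fderiv_eq_sum_covariantAcceleration [FiniteDimensional ℝ W] {ι : Type*}
    [Fintype ι] {K : ℝ} (hpos : ∀ w, w ≠ 0 → 0 < G (X y) w w) (hK : 0 ≤ K)
    (hcoercive : ∀ v, ‖v‖ ^ 2 ≤ K * inducedMetric G X y v v) {e : ι → V} {ξ : V}
    (hξ : fderiv ℝ X y ξ = ∑ i, covariantAcceleration G X y (e i)) :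
    ‖ξ‖ ≤ K * ((‖G (X y)‖ * ‖fderiv ℝ (fderiv ℝ X) y‖ * ‖fderiv ℝ X y‖
      + 3 / 2 * (‖fderiv ℝ G (X y)‖ * ‖fderiv ℝ X y‖ ^ 3)) * ∑ i, ‖e i‖ ^ 2) := by
  set M := ‖G (X y)‖ * ‖fderiv ℝ (fderiv ℝ X) y‖ * ‖fderiv ℝ X y‖
    + 3 / 2 * (‖fderiv ℝ G (X y)‖ * ‖fderiv ℝ X y‖ ^ 3)
  have hsum : inducedMetric G X y ξ ξ ≤ M * (∑ i, ‖e i‖ ^ 2) * ‖ξ‖ :=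
    calc inducedMetric G X y ξ ξ
        = ∑ i, G (X y) (covariantAcceleration G X y (e i)) (fderiv ℝ X y ξ) := by
          rw [← sum_apply, ← map_sum, ← hξ, inducedMetric_apply]
      _ ≤ ∑ i, M * (‖e i‖ ^ 2 * ‖ξ‖) := Finset.sum_le_sum fun i _ =>
          (le_abs_self _).trans (abs_apply_covariantAcceleration_le hpos (e i) ξ)
      _ = M * (∑ i, ‖e i‖ ^ 2) * ‖ξ‖ := by
          rw [← Finset.mul_sum, ← Finset.sum_mul, mul_assoc]
  rcases eq_or_ne ξ 0 with rfl | hξ0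
  · rw [norm_zero]; positivity
  · refine le_of_mul_le_mul_right ?_ (norm_pos_iff.2 hξ0)
    calc ‖ξ‖ * ‖ξ‖ = ‖ξ‖ ^ 2 := (pow_two _).symm
      _ ≤ K * (M * (∑ i, ‖e i‖ ^ 2) * ‖ξ‖) := (hcoercive ξ).trans (by gcongr)
      _ = K * (M * ∑ i, ‖e i‖ ^ 2) * ‖ξ‖ := by ring

end LocalGeometry

/-- `ξ` is the drift of the Laplacian of the induced metric: it is the sum of the Christoffel
symbols `Γ(e i, e i)` of that metric. -/
theorem exists_eventually_isEllipticFrame_and_norm_le {V W : Type*} [NormedAddCommGroup V]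
    [InnerProductSpace ℝ V] [FiniteDimensional ℝ V] [NormedAddCommGroup W] [NormedSpace ℝ W]
    [FiniteDimensional ℝ W] {G : W → W →L[ℝ] W →L[ℝ] ℝ} {X : V → W} {p : V}
    (hG : ContDiffAt ℝ 1 G (X p)) (hX : ContDiffAt ℝ 2 X p)
    (hpos : ∀ w, w ≠ 0 → 0 < G (X p) w w) (hinj : Function.Injective (fderiv ℝ X p)) :
    ∃ Λ D : ℝ, ∀ᶠ y in 𝓝 p, ∀ e : Basis (Fin (finrank ℝ V)) ℝ V, IsInducedOrthonormal G X y e →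
      IsEllipticFrame Λ e ∧
      ∀ ξ, fderiv ℝ X y ξ = ∑ i, covariantAcceleration G X y (e i) → ‖ξ‖ ≤ D := by
  have hind : ContinuousAt (inducedMetric G X) p :=
    (contDiffAt_inducedMetric hG hX).continuousAt
  obtain ⟨K, hK, hcoercive⟩ := exists_eventually_norm_sq_le hind (inducedMetric_pos hpos hinj)
  have hGX : ContinuousAt (fun y => G (X y)) p := hG.continuousAt.comp hX.continuousAt
  have hDG : ContinuousAt (fun y => fderiv ℝ G (X y)) p :=
    (hG.fderiv_right (m := 0) le_rfl).continuousAt.comp hX.continuousAt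
  have hDX : ContDiffAt ℝ 1 (fderiv ℝ X) p := hX.fderiv_right le_rfl
  have hD2X : ContinuousAt (fderiv ℝ (fderiv ℝ X)) p :=
    (hDX.fderiv_right (m := 0) le_rfl).continuousAt
  set Λ : V → ℝ := fun y => max (finrank ℝ V * K) ‖inducedMetric G X y‖
  have hΛ : ContinuousAt Λ p := continuousAt_const.max hind.norm
  set D : V → ℝ := fun y => K * ((‖G (X y)‖ * ‖fderiv ℝ (fderiv ℝ X) y‖ * ‖fderiv ℝ X y‖
      + 3 / 2 * (‖fderiv ℝ G (X y)‖ * ‖fderiv ℝ X y‖ ^ 3)) * Λ y)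
  have hD : ContinuousAt D p := continuousAt_const.mul
    ((((hGX.norm.mul hD2X.norm).mul hDX.continuousAt.norm).add
      (continuousAt_const.mul (hDG.norm.mul (hDX.continuousAt.norm.pow 3)))).mul hΛ)
  refine ⟨Λ p + 1, D p + 1, ?_⟩
  filter_upwards [hcoercive, eventually_pos hGX hpos, hΛ.eventually_lt_const (lt_add_one _),
    hD.eventually_lt_const (lt_add_one _)] with y hcoercive hpos hΛy hDy e he
  have hframe := isEllipticFrame_of_orthonormal hcoercive he
  refine ⟨hframe.mono hΛy.le, fun ξ hξ => ?_⟩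
  refine (norm_le_of_fderiv_eq_sum_covariantAcceleration hpos hK.le hcoercive hξ).trans
    (le_trans ?_ hDy.le)
  simp only [D]
  gcongr
  exact hframe.sum_norm_sq_le

/-! ### Split metrics on a product of vector spaces -/

section SplitMetric

variable {E : Type*} [NormedAddCommGroup E] [NormedSpace ℝ E]

/-- The metric `β dt² + γ` on (an open subset of) `ℝ × E`, with `γ` acting on the `E`-components
of tangent vectors and depending on both variables. -/
def localSplitMetric (β : ℝ → ℝ) (γ : ℝ × E → E →L[ℝ] E →L[ℝ] ℝ) (q : ℝ × E) :
    ℝ × E →L[ℝ] ℝ × E →L[ℝ] ℝ :=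
  β q.1 • (ContinuousLinearMap.mul ℝ ℝ).bilinearComp (.fst ℝ ℝ E) (.fst ℝ ℝ E)
    + (γ q).bilinearComp (.snd ℝ ℝ E) (.snd ℝ ℝ E)

variable {β : ℝ → ℝ} {γ : ℝ × E → E →L[ℝ] E →L[ℝ] ℝ} {q : ℝ × E}

theorem localSplitMetric_apply (a b : ℝ × E) :
    localSplitMetric β γ q a b = β q.1 * (a.1 * b.1) + γ q a.2 b.2 :=
  rfl

theorem localSplitMetric_pos (hβ : 0 < β q.1) (hγ : ∀ v, v ≠ 0 → 0 < γ q v v) (a : ℝ × E)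
    (ha : a ≠ 0) : 0 < localSplitMetric β γ q a a := by
  rw [localSplitMetric_apply]
  rcases eq_or_ne a.2 0 with h | h
  · have ha1 : a.1 ≠ 0 := fun h' => ha (Prod.ext h' h)
    have : 0 < a.1 * a.1 := mul_self_pos.2 ha1
    rw [h, map_zero, add_zero]
    positivity
  · have := hγ _ h
    have := mul_self_nonneg a.1
    positivity

theorem contDiffAt_localSplitMetric {n : WithTop ℕ∞} (hβ : ContDiffAt ℝ n β q.1)
    (hγ : ContDiffAt ℝ n γ q) : ContDiffAt ℝ n (localSplitMetric β γ) q :=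
  ((hβ.comp q contDiffAt_fst).smul contDiffAt_const).add
    (contDiffAt_bilinearComp hγ contDiffAt_const contDiffAt_const)

theorem fderiv_apply_apply {W : Type*} [NormedAddCommGroup W] [NormedSpace ℝ W]
    {G : E → W →L[ℝ] W →L[ℝ] ℝ} {y : E} (hG : DifferentiableAt ℝ G y) (a b : W) (c : E) :
    fderiv ℝ (fun y => G y a b) y c = fderiv ℝ G y c a b := by
  have := ((hG.hasFDerivAt.clm_apply (hasFDerivAt_const a y)).clm_apply
    (hasFDerivAt_const b y)).fderiv
  rw [this]
  simp

theorem fderiv_localSplitMetric_apply (hβ : ContDiffAt ℝ 1 β q.1) (hγ : ContDiffAt ℝ 1 γ q)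
    (a b c : ℝ × E) :
    fderiv ℝ (localSplitMetric β γ) q c a b
      = deriv β q.1 * c.1 * (a.1 * b.1) + fderiv ℝ γ q c a.2 b.2 := by
  have hγ' := hγ.differentiableAt one_ne_zero
  have hβ' : HasFDerivAt (fun q : ℝ × E => β q.1) (deriv β q.1 • .fst ℝ ℝ E) q :=
    (hβ.differentiableAt one_ne_zero).hasDerivAt.comp_hasFDerivAt q hasFDerivAt_fst
  have hγab : DifferentiableAt ℝ (fun q => γ q a.2 b.2) q := by fun_prop
  rw [← fderiv_apply_apply ((contDiffAt_localSplitMetric hβ hγ).differentiableAt one_ne_zero),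
    ← fderiv_apply_apply hγ']
  simp only [localSplitMetric_apply]
  rw [((hβ'.mul_const (a.1 * b.1)).fun_add hγab.hasFDerivAt).fderiv]
  simp only [add_apply, smul_apply, ContinuousLinearMap.coe_fst', smul_eq_mul]
  ring

variable [FiniteDimensional ℝ E]

theorem two_mul_fst_christoffel_localSplitMetric (hβ : ContDiffAt ℝ 1 β q.1)
    (hγ : ContDiffAt ℝ 1 γ q) (hβ0 : 0 < β q.1) (hγ0 : ∀ v, v ≠ 0 → 0 < γ q v v) (a : ℝ × E) :
    2 * (β q.1 * (christoffel (localSplitMetric β γ) q a a).1)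
      = deriv β q.1 * a.1 ^ 2 - fderiv ℝ γ q (1, 0) a.2 a.2 := by
  have h := christoffel_spec (localSplitMetric β γ) q a a (localSplitMetric_pos hβ0 hγ0) (1, 0)
  simp only [fderiv_localSplitMetric_apply hβ hγ, localSplitMetric_apply, map_zero, mul_one,
    add_zero] at h
  rw [h]
  ring

theorem snd_christoffel_localSplitMetric (hβ : ContDiffAt ℝ 1 β q.1) (hγ : ContDiffAt ℝ 1 γ q)
    (hβ0 : 0 < β q.1) (hγ0 : ∀ v, v ≠ 0 → 0 < γ q v v) (a b : E) :
    (christoffel (localSplitMetric β γ) q (0, a) (0, b)).2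
      = christoffel (fun y => γ (q.1, y)) q.2 a b := by
  have hslice : ∀ c, fderiv ℝ (fun y => γ (q.1, y)) q.2 c = fderiv ℝ γ q (0, c) := by
    have : HasFDerivAt (fun y => γ (q.1, y)) _ q.2 :=
      (hγ.differentiableAt one_ne_zero).hasFDerivAt.comp (f := fun y => (q.1, y)) q.2
        (hasFDerivAt_prodMk_right q.1 q.2)
    intro c
    rw [this.fderiv]
    rfl
  refine IsChristoffelVector.eq_christoffel hγ0 fun c => ?_
  have h := christoffel_spec (localSplitMetric β γ) q (0, a) (0, b)
    (localSplitMetric_pos hβ0 hγ0) (0, c)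
  simpa only [fderiv_localSplitMetric_apply hβ hγ, localSplitMetric_apply, mul_zero, zero_mul,
    zero_add, hslice] using h

end SplitMetric

section Components

variable {V W Z : Type*} [NormedAddCommGroup V] [NormedSpace ℝ V] [NormedAddCommGroup W]
  [NormedSpace ℝ W] [NormedAddCommGroup Z] [NormedSpace ℝ Z] {X : V → W} {y : V}

theorem fderiv_clm_comp_apply (L : W →L[ℝ] Z) (hX : DifferentiableAt ℝ X y) (v : V) :
    fderiv ℝ (fun z => L (X z)) y v = L (fderiv ℝ X y v) := by
  have : HasFDerivAt (fun z => L (X z)) (L.comp (fderiv ℝ X y)) y :=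
    L.hasFDerivAt.comp y hX.hasFDerivAt
  rw [this.fderiv]
  rfl

theorem fderiv_fderiv_clm_comp_apply (L : W →L[ℝ] Z) (hX : ContDiffAt ℝ 2 X y) (v w : V) :
    fderiv ℝ (fderiv ℝ fun z => L (X z)) y v w = L (fderiv ℝ (fderiv ℝ X) y v w) := by
  have hfderiv : fderiv ℝ (fun z => L (X z)) =ᶠ[𝓝 y]
      fun z => ContinuousLinearMap.compL ℝ V W Z L (fderiv ℝ X z) := by
    filter_upwards [hX.eventually (by simp)] with z hz
    exact ContinuousLinearMap.ext (fderiv_clm_comp_apply L (hz.differentiableAt two_ne_zero))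
  have hDX : DifferentiableAt ℝ (fderiv ℝ X) y :=
    (hX.fderiv_right (m := 1) le_rfl).differentiableAt one_ne_zero
  rw [hfderiv.fderiv_eq, fderiv_clm_comp_apply _ hDX]
  rfl

theorem abs_sum_mul_fst_le {ι : Type*} [Fintype ι] (ℓ : V →L[ℝ] ℝ) (T : V →L[ℝ] ℝ × Z)
    (e : ι → V) : |∑ i, ℓ (e i) * (T (e i)).1| ≤ ‖ℓ‖ * ‖T‖ * ∑ i, ‖e i‖ ^ 2 := by
  rw [Finset.mul_sum]
  refine (Finset.abs_sum_le_sum_abs _ _).trans (Finset.sum_le_sum fun i _ => ?_)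
  rw [abs_mul, pow_two, mul_mul_mul_comm]
  exact mul_le_mul (ℓ.le_opNorm _) ((norm_fst_le _).trans (T.le_opNorm _)) (abs_nonneg _)
    (by positivity)

end Components

section SplitSubmanifold

variable {V E : Type*} [NormedAddCommGroup V] [NormedSpace ℝ V]
  [NormedAddCommGroup E] [NormedSpace ℝ E] [FiniteDimensional ℝ E] {β : ℝ → ℝ}
  {γ : ℝ × E → E →L[ℝ] E →L[ℝ] ℝ} {X : V → ℝ × E} {y : V}

theorem two_mul_fst_covariantAcceleration (hβ : ContDiffAt ℝ 1 β (X y).1)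
    (hγ : ContDiffAt ℝ 1 γ (X y)) (hβ0 : 0 < β (X y).1) (hγ0 : ∀ v, v ≠ 0 → 0 < γ (X y) v v)
    (v : V) :
    2 * (β (X y).1 * (covariantAcceleration (localSplitMetric β γ) X y v).1)
      = 2 * β (X y).1 * (fderiv ℝ (fderiv ℝ X) y v v).1
        + deriv β (X y).1 * (fderiv ℝ X y v).1 ^ 2
        - fderiv ℝ γ (X y) (1, 0) (fderiv ℝ X y v).2 (fderiv ℝ X y v).2 := by
  have := two_mul_fst_christoffel_localSplitMetric hβ hγ hβ0 hγ0 (fderiv ℝ X y v)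
  rw [covariantAcceleration, Prod.fst_add, mul_add, mul_add]
  linarith

/-- This is the elliptic equation `Δτ = -β' / (2 β) |∇τ|² + (2 β)⁻¹ tr ∂_t γ` of the first
component `τ` of a minimal submanifold. -/
theorem sum_fst_fderiv_fderiv_eq {ι : Type*} [Fintype ι] {e : ι → V} {ξ : V}
    (hξ : fderiv ℝ X y ξ = ∑ i, covariantAcceleration (localSplitMetric β γ) X y (e i))
    (hβ : ContDiffAt ℝ 1 β (X y).1) (hγ : ContDiffAt ℝ 1 γ (X y)) (hβ0 : 0 < β (X y).1)
    (hγ0 : ∀ v, v ≠ 0 → 0 < γ (X y) v v) :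
    ∑ i, (fderiv ℝ (fderiv ℝ X) y (e i) (e i)).1
      = (fderiv ℝ X y ξ).1
        - deriv β (X y).1 / (2 * β (X y).1) * ∑ i, (fderiv ℝ X y (e i)).1 ^ 2
        + (2 * β (X y).1)⁻¹
          * ∑ i, fderiv ℝ γ (X y) (1, 0) (fderiv ℝ X y (e i)).2 (fderiv ℝ X y (e i)).2 := by
  have hsum : 2 * β (X y).1 * (fderiv ℝ X y ξ).1
      = 2 * β (X y).1 * ∑ i, (fderiv ℝ (fderiv ℝ X) y (e i) (e i)).1
        + deriv β (X y).1 * ∑ i, (fderiv ℝ X y (e i)).1 ^ 2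
        - ∑ i, fderiv ℝ γ (X y) (1, 0) (fderiv ℝ X y (e i)).2 (fderiv ℝ X y (e i)).2 := by
    rw [hξ, Prod.fst_sum, Finset.mul_sum, Finset.mul_sum, Finset.mul_sum,
      ← Finset.sum_add_distrib, ← Finset.sum_sub_distrib]
    exact Finset.sum_congr rfl fun i _ => (mul_assoc _ _ _).trans
      (two_mul_fst_covariantAcceleration hβ hγ hβ0 hγ0 (e i))
  field_simp
  linear_combination -hsum

theorem localMeanCurvatureZero_snd (hX : ContDiffAt ℝ 2 X y)
    (hτ : ∀ᶠ z in 𝓝 y, (X z).1 = (X y).1) (hβ : ContDiffAt ℝ 1 β (X y).1)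
    (hγ : ContDiffAt ℝ 1 γ (X y)) (hβ0 : 0 < β (X y).1) (hγ0 : ∀ v, v ≠ 0 → 0 < γ (X y) v v)
    (hH : LocalMeanCurvatureZero (localSplitMetric β γ) X y) :
    LocalMeanCurvatureZero (fun v => γ ((X y).1, v)) (fun z => (X z).2) y := by
  have hX' := hX.differentiableAt two_ne_zero
  have hDX : ∀ v, fderiv ℝ X y v = (0, fderiv ℝ (fun z => (X z).2) y v) := fun v => by
    refine Prod.ext ?_ (fderiv_clm_comp_apply (.snd ℝ ℝ E) hX' v).symm
    have hconst : (fun z => (X z).1) =ᶠ[𝓝 y] fun _ => (X y).1 := hτ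
    rw [← ContinuousLinearMap.coe_fst' (R := ℝ), ← fderiv_clm_comp_apply (.fst ℝ ℝ E) hX' v]
    simp only [ContinuousLinearMap.coe_fst', hconst.fderiv_eq, fderiv_fun_const, Pi.zero_apply,
      zero_apply]
  have hacc : ∀ v, covariantAcceleration (fun v => γ ((X y).1, v)) (fun z => (X z).2) y v
      = (covariantAcceleration (localSplitMetric β γ) X y v).2 := fun v => by
    have hDDX := fderiv_fderiv_clm_comp_apply (.snd ℝ ℝ E) hX v v
    rw [covariantAcceleration, covariantAcceleration, hDX, Prod.snd_add,
      snd_christoffel_localSplitMetric hβ hγ hβ0 hγ0]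
    exact congrArg (· + _) hDDX
  refine (localMeanCurvatureZero_iff hγ0).2 fun e he => ?_
  have he' : IsInducedOrthonormal (localSplitMetric β γ) X y e := fun i j => by
    rw [localSplitMetric_apply, hDX, hDX, ← he i j]
    simp only [mul_zero, zero_add]
  obtain ⟨ξ, hξ⟩ := (localMeanCurvatureZero_iff (localSplitMetric_pos hβ0 hγ0)).1 hH e he'
  refine ⟨ξ, ?_⟩
  rw [Finset.sum_congr rfl fun i _ => hacc (e i), ← Prod.snd_sum, ← hξ, hDX]

end SplitSubmanifold

section MaximumPrinciple

variable {V E : Type*} [NormedAddCommGroup V] [InnerProductSpace ℝ V]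
  [NormedAddCommGroup E] [NormedSpace ℝ E] [FiniteDimensional ℝ E] {β : ℝ → ℝ}
  {γ : ℝ × E → E →L[ℝ] E →L[ℝ] ℝ} {X : V → ℝ × E} {p y : V}

theorem isSubsolutionAt_fst {ι : Type*} [Fintype ι] {Λ D σ : ℝ} {e : ι → V} {ξ : V}
    (he : IsEllipticFrame Λ e) (hξD : ‖ξ‖ ≤ D)
    (hξ : fderiv ℝ X y ξ = ∑ i, covariantAcceleration (localSplitMetric β γ) X y (e i))
    (hX : ContDiffAt ℝ 2 X y) (hβ : ContDiffAt ℝ 1 β (X y).1) (hγ : ContDiffAt ℝ 1 γ (X y))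
    (hβ0 : 0 < β (X y).1) (hγ0 : ∀ v, v ≠ 0 → 0 < γ (X y) v v)
    (hmono : ∀ v, 0 ≤ σ * fderiv ℝ γ (X y) (1, 0) v v) :
    IsSubsolutionAt ι Λ (D + |deriv β (X y).1 / (2 * β (X y).1)| * ‖fderiv ℝ X y‖ * Λ)
      (fun z => σ * (X z).1) y := by
  set a := deriv β (X y).1 / (2 * β (X y).1)
  set u : V → ℝ := fun z => σ * (X z).1
  have hDu : ∀ v, fderiv ℝ u y v = σ * (fderiv ℝ X y v).1 :=
    fderiv_clm_comp_apply (σ • .fst ℝ ℝ E) (hX.differentiableAt two_ne_zero)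
  have hDDu : ∀ v w, fderiv ℝ (fderiv ℝ u) y v w = σ * (fderiv ℝ (fderiv ℝ X) y v w).1 :=
    fderiv_fderiv_clm_comp_apply (σ • .fst ℝ ℝ E) hX
  set S := ∑ i, fderiv ℝ γ (X y) (1, 0) (fderiv ℝ X y (e i)).2 (fderiv ℝ X y (e i)).2
  set N := ∑ i, fderiv ℝ u y (e i) * (fderiv ℝ X y (e i)).1
  have hN : N = σ * ∑ i, (fderiv ℝ X y (e i)).1 ^ 2 := by
    simp only [N, hDu, Finset.mul_sum, mul_assoc, pow_two]
  have hequation : ∑ i, fderiv ℝ (fderiv ℝ u) y (e i) (e i)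
      = fderiv ℝ u y ξ - a * N + (2 * β (X y).1)⁻¹ * (σ * S) := by
    simp only [hDDu, ← Finset.mul_sum, sum_fst_fderiv_fderiv_eq hξ hβ hγ hβ0 hγ0, hDu, hN]
    ring
  have hS : 0 ≤ (2 * β (X y).1)⁻¹ * (σ * S) := by
    have : 0 ≤ σ * S := by
      rw [Finset.mul_sum]
      exact Finset.sum_nonneg fun i _ => hmono _
    positivity
  have hdrift : |fderiv ℝ u y ξ| ≤ ‖fderiv ℝ u y‖ * D :=
    (fderiv ℝ u y).le_of_opNorm_le_of_le le_rfl hξD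
  have hNle : |N| ≤ ‖fderiv ℝ u y‖ * ‖fderiv ℝ X y‖ * Λ :=
    (abs_sum_mul_fst_le _ _ e).trans (by gcongr; exact he.sum_norm_sq_le)
  have hfirst : |a * N| ≤ |a| * (‖fderiv ℝ u y‖ * ‖fderiv ℝ X y‖ * Λ) := by
    rw [abs_mul]
    gcongr
  refine ⟨e, he, ?_⟩
  rw [hequation]
  linarith [neg_abs_le (fderiv ℝ u y ξ), le_abs_self (a * N)]

theorem exists_eventually_isSubsolutionAt_fst [FiniteDimensional ℝ V] {σ : ℝ}
    (hX : ContDiffAt ℝ 2 X p) (hinj : Function.Injective (fderiv ℝ X p))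
    (hβ : ContDiffAt ℝ 1 β (X p).1) (hγ : ContDiffAt ℝ 1 γ (X p)) (hβ0 : 0 < β (X p).1)
    (hγ0 : ∀ v, v ≠ 0 → 0 < γ (X p) v v) (hsymm : ∀ᶠ q in 𝓝 (X p), ∀ v w, γ q v w = γ q w v)
    (hmono : ∀ᶠ q in 𝓝 (X p), ∀ v, 0 ≤ σ * fderiv ℝ γ q (1, 0) v v)
    (hH : ∀ᶠ y in 𝓝 p, LocalMeanCurvatureZero (localSplitMetric β γ) X y) :
    ∃ Λ C, 0 ≤ C ∧
      ∀ᶠ y in 𝓝 p, IsSubsolutionAt (Fin (finrank ℝ V)) Λ C (fun y => σ * (X y).1) y := by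
  have hG := contDiffAt_localSplitMetric hβ hγ
  obtain ⟨Λ, D, hΛD⟩ := exists_eventually_isEllipticFrame_and_norm_le hG hX
    (localSplitMetric_pos hβ0 hγ0) hinj
  set f : V → ℝ := fun y => |deriv β (X y).1 / (2 * β (X y).1)| * ‖fderiv ℝ X y‖ * Λ
  have hτ : ContinuousAt (fun y => (X y).1) p := hX.continuousAt.fst
  have hDX : ContinuousAt (fderiv ℝ X) p := hX.continuousAt_fderiv two_ne_zero
  have hf : ContinuousAt f p := by
    have hDβ : ContinuousAt (deriv β) (X p).1 :=
      (hβ.continuousAt_fderiv one_ne_zero).clm_apply continuousAt_const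
    have hquot : ContinuousAt (fun t => deriv β t / (2 * β t)) (X p).1 :=
      hDβ.div (continuousAt_const.mul hβ.continuousAt) (by positivity)
    exact ((hquot.comp (f := fun y => (X y).1) hτ).abs.mul hDX.norm).mul_const Λ
  refine ⟨Λ, |D + (f p + 1)|, abs_nonneg _, ?_⟩
  filter_upwards [hΛD, hH, hf.eventually_lt_const (lt_add_one _), hX.eventually (by simp),
    hX.continuousAt.eventually hsymm, hX.continuousAt.eventually hmono,
    hX.continuousAt.eventually (hγ.eventually (by simp)),
    hX.continuousAt.eventually (eventually_pos hγ.continuousAt hγ0),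
    hτ.eventually (hβ.eventually (by simp)),
    hτ.eventually (hβ.continuousAt.eventually_const_lt hβ0),
    hDX.eventually (ContinuousLinearMap.isOpen_injective.mem_nhds hinj)]
    with y hΛD hH hfy hX hsymm hmono hγ hγ0 hβ hβ0 hinj
  have hpos := localSplitMetric_pos hβ0 hγ0
  obtain ⟨e, he⟩ := exists_isInducedOrthonormal (G := localSplitMetric β γ)
    (fun a b => by rw [localSplitMetric_apply, localSplitMetric_apply, hsymm, mul_comm a.1])
    hpos hinj
  obtain ⟨ξ, hξ⟩ := (localMeanCurvatureZero_iff hpos).1 hH e he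
  obtain ⟨hframe, hξD⟩ := hΛD e he
  refine (isSubsolutionAt_fst hframe (hξD ξ hξ) hξ hX hβ hγ hβ0 hγ0 hmono).mono ?_
  exact (add_le_add le_rfl hfy.le).trans (le_abs_self _)

/-- `σ = 1` for a local maximum, `σ = -1` for a local minimum of the first component. -/
theorem eventually_fst_eq_of_isLocalMax [FiniteDimensional ℝ V] {σ : ℝ} (hσ : σ ≠ 0)
    (hX : ContDiffAt ℝ 2 X p) (hinj : Function.Injective (fderiv ℝ X p))
    (hβ : ContDiffAt ℝ 1 β (X p).1) (hγ : ContDiffAt ℝ 1 γ (X p)) (hβ0 : 0 < β (X p).1)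
    (hγ0 : ∀ v, v ≠ 0 → 0 < γ (X p) v v) (hsymm : ∀ᶠ q in 𝓝 (X p), ∀ v w, γ q v w = γ q w v)
    (hmono : ∀ᶠ q in 𝓝 (X p), ∀ v, 0 ≤ σ * fderiv ℝ γ q (1, 0) v v)
    (hH : ∀ᶠ y in 𝓝 p, LocalMeanCurvatureZero (localSplitMetric β γ) X y)
    (hmax : IsLocalMax (fun y => σ * (X y).1) p) : ∀ᶠ y in 𝓝 p, (X y).1 = (X p).1 := by
  obtain ⟨Λ, C, hC, hsub⟩ :=
    exists_eventually_isSubsolutionAt_fst hX hinj hβ hγ hβ0 hγ0 hsymm hmono hH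
  filter_upwards [eventually_eq_of_isLocalMax hC (contDiffAt_const.mul hX.fst) hsub hmax]
    with y hy using mul_left_cancel₀ hσ hy

end MaximumPrinciple

/-! ### Charts -/

section Chart

variable {E H M E' H' M' : Type*}
  [NormedAddCommGroup E] [NormedSpace ℝ E] [TopologicalSpace H]
  [TopologicalSpace M] [ChartedSpace H M]
  [NormedAddCommGroup E'] [NormedSpace ℝ E'] [TopologicalSpace H']
  [TopologicalSpace M'] [ChartedSpace H' M']
  {J : ModelWithCorners ℝ E H} {J' : ModelWithCorners ℝ E' H'}
  {c : OpenPartialHomeomorph M H} {c' : OpenPartialHomeomorph M' H'}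

theorem injective_mfderiv_of_isLocalDiffeomorphAt {f : M → M'} {p : M}
    (hf : IsLocalDiffeomorphAt J J' ∞ f p) : Function.Injective (mfderiv J J' f p) :=
  (hf.mfderivToContinuousLinearEquiv (by simp)).injective

theorem contMDiffOn_extend_symm_target (hc : c ∈ IsManifold.maximalAtlas J ∞ M) :
    ContMDiffOn 𝓘(ℝ, E) J ∞ (c.extend J).symm (c.extend J).target := by
  rw [OpenPartialHomeomorph.extend_target']
  exact contMDiffOn_extend_symm hc

section Boundaryless

variable [J.Boundaryless]

theorem isLocalDiffeomorphAt_extend (hc : c ∈ IsManifold.maximalAtlas J ∞ M) {p : M}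
    (hp : p ∈ c.source) : IsLocalDiffeomorphAt J 𝓘(ℝ, E) ∞ (c.extend J) p := by
  rw [← c.extend_source (I := J)] at hp
  exact ⟨{ c.extend J with
    open_source := c.isOpen_extend_source
    open_target := c.isOpen_extend_target
    contMDiffOn_toFun := (c.contMDiffOn_extend hc).mono c.extend_source.subset
    contMDiffOn_invFun := contMDiffOn_extend_symm_target hc }, hp, fun _ _ => rfl⟩

theorem isLocalDiffeomorphAt_extend_symm (hc : c ∈ IsManifold.maximalAtlas J ∞ M) {y : E}
    (hy : y ∈ (c.extend J).target) : IsLocalDiffeomorphAt 𝓘(ℝ, E) J ∞ (c.extend J).symm y :=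
  ⟨{ (c.extend J).symm with
    open_source := c.isOpen_extend_target
    open_target := c.isOpen_extend_source
    contMDiffOn_toFun := contMDiffOn_extend_symm_target hc
    contMDiffOn_invFun := (c.contMDiffOn_extend hc).mono c.extend_source.subset }, hy,
    fun _ _ => rfl⟩

theorem contDiffAt_extend_comp_extend_symm (hc : c ∈ IsManifold.maximalAtlas J ∞ M)
    (hc' : c' ∈ IsManifold.maximalAtlas J' ∞ M') {f : M → M'} (hf : ContMDiff J J' ∞ f) {y : E}
    (hy : y ∈ (c.extend J).target) (hfy : f ((c.extend J).symm y) ∈ c'.source) :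
    ContDiffAt ℝ ∞ (c'.extend J' ∘ f ∘ (c.extend J).symm) y :=
  contMDiffAt_iff_contDiffAt.1 <| (c'.contMDiffAt_extend hc' hfy).comp y
    (hf.contMDiffAt.comp y (isLocalDiffeomorphAt_extend_symm hc hy).contMDiffAt)

theorem injective_fderiv_extend_comp_extend_symm [J'.Boundaryless]
    (hc : c ∈ IsManifold.maximalAtlas J ∞ M) (hc' : c' ∈ IsManifold.maximalAtlas J' ∞ M')
    {f : M → M'} (hf : ContMDiff J J' ∞ f) (hinj : ∀ p, Function.Injective (mfderiv J J' f p))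
    {y : E} (hy : y ∈ (c.extend J).target) (hfy : f ((c.extend J).symm y) ∈ c'.source) :
    Function.Injective (fderiv ℝ (c'.extend J' ∘ f ∘ (c.extend J).symm) y) := by
  have hsymm := isLocalDiffeomorphAt_extend_symm hc hy
  have hext := isLocalDiffeomorphAt_extend hc' hfy
  have hsymm' := hsymm.mdifferentiableAt (by simp)
  have hf' := hf.mdifferentiableAt (by simp) (x := (c.extend J).symm y)
  rw [← mfderiv_eq_fderiv, mfderiv_comp y (hext.mdifferentiableAt (by simp)) (hf'.comp y hsymm'),
    mfderiv_comp y hf' hsymm']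
  exact (injective_mfderiv_of_isLocalDiffeomorphAt hext).comp
    ((hinj _).comp (injective_mfderiv_of_isLocalDiffeomorphAt hsymm))

theorem contMDiffOn_mfderiv_extend_symm [IsManifold J ∞ M]
    (hc : c ∈ IsManifold.maximalAtlas J ∞ M) (a : E) :
    ContMDiffOn 𝓘(ℝ, E) J.tangent ∞
      (fun y => (⟨(c.extend J).symm y, mfderiv 𝓘(ℝ, E) J (c.extend J).symm y a⟩ :
        TangentBundle J M)) (c.extend J).target := by
  have hopen : IsOpen (c.extend J).target := c.isOpen_extend_target
  have : IsManifold J 1 M := IsManifold.of_le (n := ∞) (by simp)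
  have htangentMap := (contMDiffOn_extend_symm_target hc).contMDiffOn_tangentMapWithin (m := ∞)
    (by simp) hopen.uniqueMDiffOn
  have hconst : ContMDiffOn 𝓘(ℝ, E) 𝓘(ℝ, E).tangent ∞
      (fun y => (⟨y, a⟩ : TangentBundle 𝓘(ℝ, E) E)) (c.extend J).target :=
    contMDiffOn_vectorSpace_iff_contDiffOn.2 contDiffOn_const
  refine (htangentMap.comp hconst fun y hy => hy).congr fun y hy => ?_
  simp only [Function.comp_apply, tangentMapWithin, mfderivWithin_of_isOpen hopen hy]

end Boundaryless

end Chart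

/-! ### Split metrics in product charts -/

section SplitMetricInChart

variable {k : ℕ} {F : Type*} [TopologicalSpace F] [ChartedSpace (EuclideanSpace ℝ (Fin k)) F]
  {I : Set ℝ} {β : ℝ → ℝ}
  {g : ℝ → (p : F) → TangentSpace (𝓡 k) p →L[ℝ] TangentSpace (𝓡 k) p →L[ℝ] ℝ}
  {ψ : OpenPartialHomeomorph F (EuclideanSpace ℝ (Fin k))}

/-- The components of `g_t` in the chart `ψ`, as a function of the time and the position. -/
def chartMetricFamily
    (g : ℝ → (p : F) → TangentSpace (𝓡 k) p →L[ℝ] TangentSpace (𝓡 k) p →L[ℝ] ℝ)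
    (ψ : OpenPartialHomeomorph F (EuclideanSpace ℝ (Fin k)))
    (q : ℝ × EuclideanSpace ℝ (Fin k)) :
    EuclideanSpace ℝ (Fin k) →L[ℝ] EuclideanSpace ℝ (Fin k) →L[ℝ] ℝ :=
  chartMetric (𝓡 k) (g q.1) ψ q.2

theorem chartMetricFamily_apply (q : ℝ × EuclideanSpace ℝ (Fin k))
    (v w : EuclideanSpace ℝ (Fin k)) :
    chartMetricFamily g ψ q v w = g q.1 ((ψ.extend (𝓡 k)).symm q.2)
      (mfderiv 𝓘(ℝ, EuclideanSpace ℝ (Fin k)) (𝓡 k) (ψ.extend (𝓡 k)).symm q.2 v)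
      (mfderiv 𝓘(ℝ, EuclideanSpace ℝ (Fin k)) (𝓡 k) (ψ.extend (𝓡 k)).symm q.2 w) := rfl

/-- The product of the identity of `ℝ` and a chart of `F`: the chart of `ℝ × F` in which the
components of a split metric are those of `localSplitMetric`. -/
def productChart (ψ : OpenPartialHomeomorph F (EuclideanSpace ℝ (Fin k))) :
    OpenPartialHomeomorph (ℝ × F) (ModelProd ℝ (EuclideanSpace ℝ (Fin k))) :=
  (OpenPartialHomeomorph.refl ℝ).prod ψ

theorem chartMetric_splitMetric (hψ : ψ ∈ IsManifold.maximalAtlas (𝓡 k) ∞ F)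
    {q : ℝ × EuclideanSpace ℝ (Fin k)} (hq : q.2 ∈ (ψ.extend (𝓡 k)).target) :
    chartMetric (𝓘(ℝ, ℝ).prod (𝓡 k)) (splitMetric β g) (productChart ψ) q =
      localSplitMetric β (chartMetricFamily g ψ) q := by
  have hfst : HasMFDerivAt 𝓘(ℝ, ℝ × EuclideanSpace ℝ (Fin k)) 𝓘(ℝ, ℝ) Prod.fst q
      (ContinuousLinearMap.fst ℝ ℝ (EuclideanSpace ℝ (Fin k))) :=
    hasFDerivAt_fst.hasMFDerivAt
  have hsnd : HasMFDerivAt 𝓘(ℝ, ℝ × EuclideanSpace ℝ (Fin k)) 𝓘(ℝ, EuclideanSpace ℝ (Fin k))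
      Prod.snd q (ContinuousLinearMap.snd ℝ ℝ (EuclideanSpace ℝ (Fin k))) :=
    hasFDerivAt_snd.hasMFDerivAt
  have hsymm := ((isLocalDiffeomorphAt_extend_symm hψ hq).mdifferentiableAt
    (by simp)).hasMFDerivAt
  have hmfderiv : mfderiv 𝓘(ℝ, ℝ × EuclideanSpace ℝ (Fin k)) (𝓘(ℝ, ℝ).prod (𝓡 k))
      ((productChart ψ).extend (𝓘(ℝ, ℝ).prod (𝓡 k))).symm q = _ :=
    (hfst.prodMk (hsymm.comp q hsnd)).mfderiv
  refine ContinuousLinearMap.ext fun a => ContinuousLinearMap.ext fun b => ?_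
  simp only [chartMetric, hmfderiv]
  rfl

variable [IsManifold (𝓡 k) ∞ F]

theorem productChart_mem_maximalAtlas (hψ : ψ ∈ IsManifold.maximalAtlas (𝓡 k) ∞ F) :
    productChart ψ ∈ IsManifold.maximalAtlas (𝓘(ℝ, ℝ).prod (𝓡 k)) ∞ (ℝ × F) :=
  IsManifold.mem_maximalAtlas_prod
    (StructureGroupoid.id_mem_maximalAtlas (contDiffGroupoid ∞ 𝓘(ℝ, ℝ))) hψ

theorem chartMetricFamily_symm (hg : IsRiemannianMetricFamily I g)
    {q : ℝ × EuclideanSpace ℝ (Fin k)} (hq : q.1 ∈ I) (v w : EuclideanSpace ℝ (Fin k)) :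
    chartMetricFamily g ψ q v w = chartMetricFamily g ψ q w v := by
  rw [chartMetricFamily_apply, chartMetricFamily_apply, hg.symm q.1 hq]

theorem chartMetricFamily_pos (hg : IsRiemannianMetricFamily I g)
    (hψ : ψ ∈ IsManifold.maximalAtlas (𝓡 k) ∞ F) {q : ℝ × EuclideanSpace ℝ (Fin k)}
    (hqI : q.1 ∈ I) (hq : q.2 ∈ (ψ.extend (𝓡 k)).target) {v : EuclideanSpace ℝ (Fin k)}
    (hv : v ≠ 0) : 0 < chartMetricFamily g ψ q v v := by
  rw [chartMetricFamily_apply]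
  exact hg.pos q.1 hqI _ _ fun h => hv (injective_mfderiv_of_isLocalDiffeomorphAt
    (isLocalDiffeomorphAt_extend_symm hψ hq) (h.trans (map_zero _).symm))

theorem contDiffOn_chartMetricFamily (hg : IsRiemannianMetricFamily I g)
    (hψ : ψ ∈ IsManifold.maximalAtlas (𝓡 k) ∞ F) :
    ContDiffOn ℝ ∞ (chartMetricFamily g ψ) (I ×ˢ (ψ.extend (𝓡 k)).target) := by
  refine contDiffOn_clm_apply.2 fun a => contDiffOn_clm_apply.2 fun b q hq => ?_
  rw [← contMDiffWithinAt_iff_contDiffWithinAt]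
  have hsnd : ContMDiffOn 𝓘(ℝ, ℝ × EuclideanSpace ℝ (Fin k)) 𝓘(ℝ, EuclideanSpace ℝ (Fin k)) ∞
      Prod.snd (I ×ˢ (ψ.extend (𝓡 k)).target) := contDiff_snd.contMDiff.contMDiffOn
  have hfst : ContMDiffOn 𝓘(ℝ, ℝ × EuclideanSpace ℝ (Fin k)) 𝓘(ℝ, ℝ) ∞
      Prod.fst (I ×ˢ (ψ.extend (𝓡 k)).target) := contDiff_fst.contMDiff.contMDiffOn
  have hmaps : Set.MapsTo Prod.snd (I ×ˢ (ψ.extend (𝓡 k)).target) (ψ.extend (𝓡 k)).target :=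
    fun q hq => hq.2
  have hmetric := hg.contMDiffOn.comp
    (hfst.prodMk ((contMDiffOn_extend_symm_target hψ).comp hsnd hmaps))
    (fun q hq => ⟨hq.1, Set.mem_univ _⟩)
  have hframe (v : EuclideanSpace ℝ (Fin k)) :=
    (contMDiffOn_mfderiv_extend_symm hψ v).comp hsnd hmaps
  have htotal : ContMDiffWithinAt 𝓘(ℝ, ℝ × EuclideanSpace ℝ (Fin k)) ((𝓡 k).prod 𝓘(ℝ, ℝ)) ∞
      (fun q : ℝ × EuclideanSpace ℝ (Fin k) => TotalSpace.mk' ℝ (E := Bundle.Trivial F ℝ)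
        ((ψ.extend (𝓡 k)).symm q.2) (chartMetricFamily g ψ q a b))
      (I ×ˢ (ψ.extend (𝓡 k)).target) q :=
    ContMDiffWithinAt.clm_bundle_apply₂ (F₁ := EuclideanSpace ℝ (Fin k))
      (F₂ := EuclideanSpace ℝ (Fin k)) (hmetric q hq) (hframe a q hq) (hframe b q hq)
  exact (contMDiffWithinAt_totalSpace.1 htotal).2

theorem contDiffAt_chartMetricFamily (hI : IsOpen I) (hg : IsRiemannianMetricFamily I g)
    (hψ : ψ ∈ IsManifold.maximalAtlas (𝓡 k) ∞ F) {q : ℝ × EuclideanSpace ℝ (Fin k)}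
    (hqI : q.1 ∈ I) (hq : q.2 ∈ (ψ.extend (𝓡 k)).target) :
    ContDiffAt ℝ ∞ (chartMetricFamily g ψ) q :=
  (contDiffOn_chartMetricFamily hg hψ).contDiffAt
    ((hI.prod ψ.isOpen_extend_target).mem_nhds ⟨hqI, hq⟩)

theorem fderiv_chartMetricFamily_vertical (hI : IsOpen I) (hg : IsRiemannianMetricFamily I g)
    (hψ : ψ ∈ IsManifold.maximalAtlas (𝓡 k) ∞ F) {q : ℝ × EuclideanSpace ℝ (Fin k)}
    (hqI : q.1 ∈ I) (hq : q.2 ∈ (ψ.extend (𝓡 k)).target) (v : EuclideanSpace ℝ (Fin k)) :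
    fderiv ℝ (chartMetricFamily g ψ) q (1, 0) v v =
      deriv (fun t => chartMetric (𝓡 k) (g t) ψ q.2 v v) q.1 := by
  have hγ := (contDiffAt_chartMetricFamily hI hg hψ hqI hq).differentiableAt (by simp)
  have hline : HasDerivAt (fun t : ℝ => (t, q.2)) (1, 0) q.1 :=
    (hasDerivAt_id q.1).prodMk (hasDerivAt_const _ _)
  have hcomp := (((hγ.hasFDerivAt.comp_hasDerivAt q.1 hline).clm_apply
    (hasDerivAt_const q.1 v)).clm_apply (hasDerivAt_const q.1 v)).deriv
  simpa [chartMetricFamily] using hcomp.symm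

end SplitMetricInChart
theorem exists_forall_eq_of_isLocalMax_eventually_eq {S α : Type*} [TopologicalSpace S]
    [CompactSpace S] [ConnectedSpace S] [LinearOrder α] [TopologicalSpace α]
    [OrderClosedTopology α] {u : S → α} (hu : Continuous u)
    (h : ∀ p, IsLocalMax u p → ∀ᶠ p' in 𝓝 p, u p' = u p) : ∃ p₀, ∀ p, u p = u p₀ := by
  obtain ⟨p₀, -, hp₀⟩ := isCompact_univ.exists_isMaxOn Set.univ_nonempty hu.continuousOn
  have hopen : IsOpen {p | u p = u p₀} := isOpen_iff_mem_nhds.2 fun p (hp : u p = u p₀) => by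
    have hmax : IsLocalMax u p := Eventually.of_forall fun p' => hp ▸ hp₀ (Set.mem_univ p')
    exact (h p hmax).mono fun p' hp' => hp'.trans hp
  have hclosed : IsClosed {p | u p = u p₀} := isClosed_eq hu continuous_const
  exact ⟨p₀, Set.eq_univ_iff_forall.1 (IsClopen.eq_univ ⟨hclosed, hopen⟩ ⟨p₀, rfl⟩)⟩

/-! ### Minimal submanifolds of split manifolds -/

section ChartExpression

variable {k : ℕ} {F V H S : Type*} [TopologicalSpace F]
  {ψ : OpenPartialHomeomorph F (EuclideanSpace ℝ (Fin k))}
  [NormedAddCommGroup V] [NormedSpace ℝ V] [TopologicalSpace H] [TopologicalSpace S]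
  {J : ModelWithCorners ℝ V H} {φ : OpenPartialHomeomorph S H} {x : S → ℝ × F} {p : S}

/-- The expression of `x : S → ℝ × F` in the chart `φ` of `S` and the product chart of `ψ`. -/
def chartExpression (J : ModelWithCorners ℝ V H) (φ : OpenPartialHomeomorph S H)
    (ψ : OpenPartialHomeomorph F (EuclideanSpace ℝ (Fin k))) (x : S → ℝ × F) :
    V → ℝ × EuclideanSpace ℝ (Fin k) :=
  (productChart ψ).extend (𝓘(ℝ, ℝ).prod (𝓡 k)) ∘ x ∘ (φ.extend J).symm

theorem chartExpression_extend (hp : p ∈ φ.source) :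
    chartExpression J φ ψ x (φ.extend J p) = ((x p).1, ψ.extend (𝓡 k) (x p).2) :=
  congrArg (fun p => ((x p).1, ψ.extend (𝓡 k) (x p).2)) (φ.extend_left_inv hp)

theorem chartExpression_extend_snd_mem_target (hp : p ∈ φ.source) (hxp : (x p).2 ∈ ψ.source) :
    (chartExpression J φ ψ x (φ.extend J p)).2 ∈ (ψ.extend (𝓡 k)).target := by
  rw [chartExpression_extend hp]
  exact (ψ.extend (𝓡 k)).map_source (by rwa [ψ.extend_source])

variable [ChartedSpace (EuclideanSpace ℝ (Fin k)) F] [IsManifold (𝓡 k) ∞ F]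
  [ChartedSpace H S] [J.Boundaryless]

theorem contDiffAt_chartExpression (hφ : φ ∈ IsManifold.maximalAtlas J ∞ S)
    (hψ : ψ ∈ IsManifold.maximalAtlas (𝓡 k) ∞ F)
    (hx : ContMDiff J (𝓘(ℝ, ℝ).prod (𝓡 k)) ∞ x) (hp : p ∈ φ.source)
    (hxp : (x p).2 ∈ ψ.source) :
    ContDiffAt ℝ ∞ (chartExpression J φ ψ x) (φ.extend J p) :=
  contDiffAt_extend_comp_extend_symm hφ (productChart_mem_maximalAtlas hψ) hx
    ((φ.extend J).map_source (by rwa [φ.extend_source]))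
    (by rw [φ.extend_left_inv hp]; exact ⟨Set.mem_univ _, hxp⟩)

theorem injective_fderiv_chartExpression (hφ : φ ∈ IsManifold.maximalAtlas J ∞ S)
    (hψ : ψ ∈ IsManifold.maximalAtlas (𝓡 k) ∞ F)
    (hx : ContMDiff J (𝓘(ℝ, ℝ).prod (𝓡 k)) ∞ x)
    (hinj : ∀ p, Function.Injective (mfderiv J (𝓘(ℝ, ℝ).prod (𝓡 k)) x p))
    (hp : p ∈ φ.source) (hxp : (x p).2 ∈ ψ.source) :
    Function.Injective (fderiv ℝ (chartExpression J φ ψ x) (φ.extend J p)) :=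
  injective_fderiv_extend_comp_extend_symm hφ (productChart_mem_maximalAtlas hψ) hx hinj
    ((φ.extend J).map_source (by rwa [φ.extend_source]))
    (by rw [φ.extend_left_inv hp]; exact ⟨Set.mem_univ _, hxp⟩)

end ChartExpression

namespace IsMinimalSubmanifold

variable {k : ℕ} {F V H S : Type*} [TopologicalSpace F]
  [ChartedSpace (EuclideanSpace ℝ (Fin k)) F] {I : Set ℝ} {β : ℝ → ℝ}
  {g : ℝ → (p : F) → TangentSpace (𝓡 k) p →L[ℝ] TangentSpace (𝓡 k) p →L[ℝ] ℝ}
  [TopologicalSpace H] [TopologicalSpace S] [ChartedSpace H S] {x : S → ℝ × F}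

section Slice

variable [NormedAddCommGroup V] [NormedSpace ℝ V] {J : ModelWithCorners ℝ V H}
  {ψ : OpenPartialHomeomorph F (EuclideanSpace ℝ (Fin k))} {φ : OpenPartialHomeomorph S H}

theorem injective_mfderiv_snd
    (hx : IsMinimalSubmanifold J (𝓘(ℝ, ℝ).prod (𝓡 k)) (splitMetric β g) x) {t : ℝ}
    (hxt : ∀ p, (x p).1 = t) (p : S) :
    Function.Injective (mfderiv J (𝓡 k) (fun p => (x p).2) p) := by
  have hsnd : MDifferentiableAt J (𝓡 k) (fun p => (x p).2) p :=
    hx.contMDiff.snd.mdifferentiableAt (by simp)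
  have hprod : HasMFDerivAt J (𝓘(ℝ, ℝ).prod (𝓡 k)) x p
      ((0 : V →L[ℝ] ℝ).prod
        (mfderiv J (𝓡 k) (fun p => (x p).2) p : V →L[ℝ] EuclideanSpace ℝ (Fin k))) :=
    ((hasMFDerivAt_const t p).prodMk hsnd.hasMFDerivAt).congr_of_eventuallyEq
      (Eventually.of_forall fun p => Prod.ext (hxt p) rfl)
  intro a b hab
  refine hx.injective_mfderiv p ?_
  rw [hprod.mfderiv]
  exact Prod.ext rfl hab

variable [IsManifold (𝓡 k) ∞ F]

theorem localMeanCurvatureZero_chartExpression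
    (hx : IsMinimalSubmanifold J (𝓘(ℝ, ℝ).prod (𝓡 k)) (splitMetric β g) x)
    (hφ : φ ∈ IsManifold.maximalAtlas J ∞ S) (hψ : ψ ∈ IsManifold.maximalAtlas (𝓡 k) ∞ F)
    {p : S} (hp : p ∈ φ.source) (hxp : (x p).2 ∈ ψ.source) :
    LocalMeanCurvatureZero (localSplitMetric β (chartMetricFamily g ψ))
      (chartExpression J φ ψ x) (φ.extend J p) := by
  refine (hx.meanCurvature_eq_zero φ hφ _ (productChart_mem_maximalAtlas hψ) p hp
    ⟨Set.mem_univ _, hxp⟩).congr_metric ?_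
  filter_upwards [continuous_snd.continuousAt.preimage_mem_nhds (ψ.isOpen_extend_target.mem_nhds
    (chartExpression_extend_snd_mem_target hp hxp))] with q hq
  exact chartMetric_splitMetric hψ hq

theorem eventually_localMeanCurvatureZero_chartExpression [J.Boundaryless]
    (hx : IsMinimalSubmanifold J (𝓘(ℝ, ℝ).prod (𝓡 k)) (splitMetric β g) x)
    (hφ : φ ∈ IsManifold.maximalAtlas J ∞ S) (hψ : ψ ∈ IsManifold.maximalAtlas (𝓡 k) ∞ F)
    {p : S} (hp : p ∈ φ.source) (hxp : (x p).2 ∈ ψ.source) :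
    ∀ᶠ y in 𝓝 (φ.extend J p), LocalMeanCurvatureZero
      (localSplitMetric β (chartMetricFamily g ψ)) (chartExpression J φ ψ x) y := by
  rw [← φ.map_extend_nhds_of_boundaryless hp, eventually_map]
  filter_upwards [φ.open_source.mem_nhds hp,
    hx.contMDiff.continuous.snd.continuousAt.preimage_mem_nhds (ψ.open_source.mem_nhds hxp)]
    with p' hp' hxp' using hx.localMeanCurvatureZero_chartExpression hφ hψ hp' hxp'

theorem snd_of_fst_eq [J.Boundaryless] (hI : IsOpen I) (hβ : ContDiffOn ℝ ∞ β I)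
    (hβ0 : ∀ t ∈ I, 0 < β t) (hg : IsRiemannianMetricFamily I g)
    (hx : IsMinimalSubmanifold J (𝓘(ℝ, ℝ).prod (𝓡 k)) (splitMetric β g) x) {t : ℝ}
    (ht : t ∈ I) (hxt : ∀ p, (x p).1 = t) :
    IsMinimalSubmanifold J (𝓡 k) (g t) fun p => (x p).2 where
  contMDiff := hx.contMDiff.snd
  injective_mfderiv := hx.injective_mfderiv_snd hxt
  meanCurvature_eq_zero φ hφ ψ hψ p hp hxp := by
    have hX : ∀ y, (chartExpression J φ ψ x y).1 = t := fun y => hxt _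
    have htarget := chartExpression_extend_snd_mem_target (J := J) hp hxp
    have hXI : (chartExpression J φ ψ x (φ.extend J p)).1 ∈ I := (hX _).symm ▸ ht
    have hH := localMeanCurvatureZero_snd
      ((contDiffAt_chartExpression hφ hψ hx.contMDiff hp hxp).of_le ENat.LEInfty.out)
      (Eventually.of_forall fun y => (hX y).trans (hX _).symm)
      ((hβ.contDiffAt (hI.mem_nhds hXI)).of_le ENat.LEInfty.out)
      ((contDiffAt_chartMetricFamily hI hg hψ hXI htarget).of_le ENat.LEInfty.out) (hβ0 _ hXI)
      (fun v hv => chartMetricFamily_pos hg hψ hXI htarget hv)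
      (hx.localMeanCurvatureZero_chartExpression hφ hψ hp hxp)
    rw [hX] at hH
    exact hH

end Slice

section MaximumPrinciple

variable [IsManifold (𝓡 k) ∞ F] [NormedAddCommGroup V] [InnerProductSpace ℝ V]
  [FiniteDimensional ℝ V] {J : ModelWithCorners ℝ V H} [J.Boundaryless] [IsManifold J ∞ S]

theorem eventually_fst_eq_of_isLocalMax (hI : IsOpen I) (hβ : ContDiffOn ℝ ∞ β I)
    (hβ0 : ∀ t ∈ I, 0 < β t) (hg : IsRiemannianMetricFamily I g) {σ : ℝ} (hσ : σ ≠ 0)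
    (hmono : ∀ t ∈ I, ∀ (p : F) (v : TangentSpace (𝓡 k) p),
      0 ≤ σ * deriv (fun s => g s p v v) t)
    (hx : IsMinimalSubmanifold J (𝓘(ℝ, ℝ).prod (𝓡 k)) (splitMetric β g) x) {p : S}
    (hpI : (x p).1 ∈ I) (hmax : IsLocalMax (fun p => σ * (x p).1) p) :
    ∀ᶠ p' in 𝓝 p, (x p').1 = (x p).1 := by
  have hφ := IsManifold.chart_mem_maximalAtlas (I := J) (n := ∞) p
  have hψ := IsManifold.chart_mem_maximalAtlas (I := 𝓡 k) (n := ∞) (x p).2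
  set φ := chartAt H p
  set ψ := chartAt (EuclideanSpace ℝ (Fin k)) (x p).2
  have hp : p ∈ φ.source := mem_chart_source H p
  have hxp : (x p).2 ∈ ψ.source := mem_chart_source _ (x p).2
  have hpφ : ∀ᶠ p' in 𝓝 p, p' ∈ φ.source := φ.open_source.mem_nhds hp
  have htarget := chartExpression_extend_snd_mem_target (J := J) hp hxp
  have hXI : (chartExpression J φ ψ x (φ.extend J p)).1 ∈ I := by rwa [chartExpression_extend hp]
  have hdomain : ∀ᶠ q in 𝓝 (chartExpression J φ ψ x (φ.extend J p)),
      q.1 ∈ I ∧ q.2 ∈ (ψ.extend (𝓡 k)).target :=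
    (hI.prod ψ.isOpen_extend_target).mem_nhds ⟨hXI, htarget⟩
  have hmax' : IsLocalMax (fun y => σ * (chartExpression J φ ψ x y).1) (φ.extend J p) := by
    change ∀ᶠ y in 𝓝 (φ.extend J p), _
    rw [← φ.map_extend_nhds_of_boundaryless hp, eventually_map]
    filter_upwards [hmax, hpφ] with p' hp' hp'φ
    rwa [chartExpression_extend hp'φ, chartExpression_extend hp]
  have hconst := MinimalSubmanifolds.eventually_fst_eq_of_isLocalMax hσ
    ((contDiffAt_chartExpression hφ hψ hx.contMDiff hp hxp).of_le ENat.LEInfty.out)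
    (injective_fderiv_chartExpression hφ hψ hx.contMDiff hx.injective_mfderiv hp hxp)
    ((hβ.contDiffAt (hI.mem_nhds hXI)).of_le ENat.LEInfty.out)
    ((contDiffAt_chartMetricFamily hI hg hψ hXI htarget).of_le ENat.LEInfty.out) (hβ0 _ hXI)
    (fun v hv => chartMetricFamily_pos hg hψ hXI htarget hv)
    (hdomain.mono fun q hq => chartMetricFamily_symm hg hq.1)
    (hdomain.mono fun q hq v => by
      rw [fderiv_chartMetricFamily_vertical hI hg hψ hq.1 hq.2]; exact hmono _ hq.1 _ _)
    (hx.eventually_localMeanCurvatureZero_chartExpression hφ hψ hp hxp) hmax'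
  rw [← φ.map_extend_nhds_of_boundaryless hp, eventually_map] at hconst
  filter_upwards [hconst, hpφ] with p' hp' hp'φ
  rwa [chartExpression_extend hp'φ, chartExpression_extend hp] at hp'

theorem exists_fst_eq [CompactSpace S] [ConnectedSpace S] (hI : IsOpen I)
    (hβ : ContDiffOn ℝ ∞ β I) (hβ0 : ∀ t ∈ I, 0 < β t) (hg : IsRiemannianMetricFamily I g)
    {σ : ℝ} (hσ : σ ≠ 0)
    (hmono : ∀ t ∈ I, ∀ (p : F) (v : TangentSpace (𝓡 k) p),
      0 ≤ σ * deriv (fun s => g s p v v) t)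
    (hx : IsMinimalSubmanifold J (𝓘(ℝ, ℝ).prod (𝓡 k)) (splitMetric β g) x)
    (hxI : ∀ p, (x p).1 ∈ I) : ∃ t₀ ∈ I, ∀ p, (x p).1 = t₀ := by
  obtain ⟨p₀, hp₀⟩ := exists_forall_eq_of_isLocalMax_eventually_eq
    (continuous_const.mul hx.contMDiff.continuous.fst) fun p hp =>
      (hx.eventually_fst_eq_of_isLocalMax hI hβ hβ0 hg hσ hmono (hxI p) hp).mono
        fun p' hp' => congrArg (σ * ·) hp'
  exact ⟨(x p₀).1, hxI p₀, fun p => mul_left_cancel₀ hσ (hp₀ p)⟩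

end MaximumPrinciple

end IsMinimalSubmanifold
end MinimalSubmanifolds

end

open MinimalSubmanifolds in
theorem mainTheorem1_general {k : ℕ}
    {F : Type*} [TopologicalSpace F] [ChartedSpace (EuclideanSpace ℝ (Fin k)) F]
    [IsManifold (𝓡 k) ∞ F]
    {V H S : Type*} [NormedAddCommGroup V] [InnerProductSpace ℝ V] [FiniteDimensional ℝ V]
    [TopologicalSpace H] {J : ModelWithCorners ℝ V H} [J.Boundaryless]
    [TopologicalSpace S] [CompactSpace S] [ConnectedSpace S] [ChartedSpace H S]
    [IsManifold J ∞ S]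
    {I : Set ℝ} (hI : IsOpen I) {β : ℝ → ℝ} (hβ : ContDiffOn ℝ ∞ β I)
    (hβ0 : ∀ t ∈ I, 0 < β t)
    {g : ℝ → (p : F) → TangentSpace (𝓡 k) p →L[ℝ] TangentSpace (𝓡 k) p →L[ℝ] ℝ}
    (hg : IsRiemannianMetricFamily I g)
    (hmono : (∀ t ∈ I, ∀ (p : F) (v : TangentSpace (𝓡 k) p), 0 ≤ deriv (fun s => g s p v v) t) ∨
      ∀ t ∈ I, ∀ (p : F) (v : TangentSpace (𝓡 k) p), deriv (fun s => g s p v v) t ≤ 0)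
    {x : S → ℝ × F} (hxI : ∀ p, (x p).1 ∈ I)
    (hx : IsMinimalSubmanifold J (𝓘(ℝ, ℝ).prod (𝓡 k)) (splitMetric β g) x) :
    ∃ t₀ ∈ I, (∀ p, (x p).1 = t₀) ∧
      IsMinimalSubmanifold J (𝓡 k) (g t₀) (fun p => (x p).2) := by
  obtain ⟨σ, hσ, hσg⟩ : ∃ σ : ℝ, σ ≠ 0 ∧ ∀ t ∈ I, ∀ (p : F) (v : TangentSpace (𝓡 k) p),
      0 ≤ σ * deriv (fun s => g s p v v) t := by
    rcases hmono with h | h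
    · exact ⟨1, one_ne_zero, fun t ht p v => by simpa only [one_mul] using h t ht p v⟩
    · exact ⟨-1, neg_ne_zero.2 one_ne_zero, fun t ht p v =>
        mul_nonneg_of_nonpos_of_nonpos (by norm_num) (h t ht p v)⟩
  obtain ⟨t₀, ht₀, hxt₀⟩ := hx.exists_fst_eq hI hβ hβ0 hg hσ hσg hxI
  exact ⟨t₀, ht₀, hxt₀, hx.snd_of_fst_eq hI hβ hβ0 hg ht₀ hxt₀⟩

theorem mainTheorem1 {n k : ℕ}
    {F : Type*} [TopologicalSpace F] [T2Space F]
    [ChartedSpace (EuclideanSpace ℝ (Fin k)) F] [IsManifold (𝓡 k) ∞ F]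
    {S : Type*} [TopologicalSpace S] [T2Space S] [CompactSpace S] [ConnectedSpace S]
    [ChartedSpace (EuclideanSpace ℝ (Fin n)) S] [IsManifold (𝓡 n) ∞ S]
    (I : Set ℝ) (hI_open : IsOpen I) (hI_interval : I.OrdConnected)
    (β : ℝ → ℝ) (hβ_smooth : ContDiffOn ℝ ∞ β I) (hβ_pos : ∀ t ∈ I, 0 < β t)
    (g : ℝ → (p : F) → TangentSpace (𝓡 k) p →L[ℝ] TangentSpace (𝓡 k) p →L[ℝ] ℝ)
    (hg : MinimalSubmanifolds.IsRiemannianMetricFamily I g)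
    (hmono : MinimalSubmanifolds.IsMonotone I β g)
    (x : S → ℝ × F) (hxI : ∀ p, (x p).1 ∈ I)
    (hx : MinimalSubmanifolds.IsMinimalSubmanifold (𝓡 n) (𝓘(ℝ, ℝ).prod (𝓡 k))
      (MinimalSubmanifolds.splitMetric β g) x) :
    ∃ t₀ ∈ I, (∀ p, (x p).1 = t₀) ∧
      -- the codimension of `S` in `I × F` is `k + 1 - n`
      (n + 1 < k + 1 → MinimalSubmanifolds.IsMinimalSubmanifold (𝓡 n) (𝓡 k) (g t₀)
        (fun p => (x p).2)) := by
  obtain ⟨t₀, ht₀, hxt₀, hmin⟩ := mainTheorem1_general hI_open hβ_smooth hβ_pos hg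
    (hmono.imp (fun h t ht => (h t ht).2) fun h t ht => (h t ht).2) hxI hx
  exact ⟨t₀, ht₀, hxt₀, fun _ => hmin⟩
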